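/- Let $N\ge 2$, let $M\subseteq\mathbb R^N$ be open, let $g_{\mathrm E}$ be the Euclidean metric, let $\varphi\in C^\infty(M)$, and put $g=e^{2\varphi}g_{\mathrm E}$, with scalar curvature $R_g$. Let $\Omega$ be a nonempty open set (for instance a domain) whose closure is compact and contained in $M$. For a metric $h$ and a positive weight $\rho$ let $\lambda_1(\Omega,\Delta_h,\rho)\le\lambda_2(\Omega,\Delta_h,\rho)\le\cdots$ be the eigenvalues, repeated with multiplicity, of the Dirichlet problem $$-\Delta_h u=\lambda\rho u\ \text{ in }\Omega,\qquad u=0\ \text{ on }\partial\Omega,$$ understood weakly with $u\in H^1_0(\Omega,h)$, and let $\Gamma(\Omega,\Delta_h,\rho)=\lambda_2(\Omega,\Delta_h,\rho)-\lambda_1(\Omega,\Delta_h,\rho)$ be the fundamental gap; write $\Gamma(\Omega,\Delta_h)=\Gamma(\Omega,\Delta_h,1)$ and $\operatorname{osc}_\Omega f=\sup_\Omega f-\inf_\Omega f$. Then $$\Gamma(\Omega,\Delta_g)\ \ge\ \Gamma(\Omega,\Delta_{g_{\mathrm E}},e^{2\varphi})-\frac{N-2}{4(N-1)}\operatorname{osc}_\Omega(R_g).$$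 If moreover $R_g$ is constant on $\Omega$, then $\Gamma(\Omega,\Delta_g)=\Gamma(\Omega,\Delta_{g_{\mathrm E}},e^{2\varphi})$. -/

import Mathlib

open scoped ContDiff

noncomputable section

namespace DirichletGap

open MeasureTheory Filter Topology

variable {N : ℕ}

/-! ### Riemannian metrics in coordinates

A Riemannian metric on an open subset of `ℝ^N` is given by its coefficient matrices
`x ↦ (g_{ij}(x))`. -/

/-- The partial derivative `∂_i f (x)`. -/
def pderiv (i : Fin N) (f : EuclideanSpace ℝ (Fin N) → ℝ) (x : EuclideanSpace ℝ (Fin N)) : ℝ :=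
  fderiv ℝ f x (EuclideanSpace.single i 1)

/-- The Euclidean metric `g_E`. -/
def euclideanMetric (N : ℕ) : EuclideanSpace ℝ (Fin N) → Matrix (Fin N) (Fin N) ℝ :=
  fun _ => 1

/-- The conformal metric `e^{2φ} g_E`. -/
def conformalMetric (φ : EuclideanSpace ℝ (Fin N) → ℝ) :
    EuclideanSpace ℝ (Fin N) → Matrix (Fin N) (Fin N) ℝ :=
  fun x => Real.exp (2 * φ x) • euclideanMetric N x

/-- Christoffel symbols of the Levi-Civita connection,
`Γ^k_{ij} = ½ ∑_l g^{kl} (∂_i g_{jl} + ∂_j g_{il} - ∂_l g_{ij})`. -/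
def christoffel (g : EuclideanSpace ℝ (Fin N) → Matrix (Fin N) (Fin N) ℝ) (k i j : Fin N)
    (x : EuclideanSpace ℝ (Fin N)) : ℝ :=
  (1 / 2 : ℝ) * ∑ l, (g x)⁻¹ k l *
    (pderiv i (fun y => g y j l) x + pderiv j (fun y => g y i l) x
      - pderiv l (fun y => g y i j) x)

/-- The coefficients `R^l_{kij}` of the curvature tensor,
`R(∂_i, ∂_j) ∂_k = ∇_i ∇_j ∂_k - ∇_j ∇_i ∂_k = ∑_l R^l_{kij} ∂_l`. -/
def riemannCurvature (g : EuclideanSpace ℝ (Fin N) → Matrix (Fin N) (Fin N) ℝ)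
    (l k i j : Fin N) (x : EuclideanSpace ℝ (Fin N)) : ℝ :=
  pderiv i (christoffel g l j k) x - pderiv j (christoffel g l i k) x
    + ∑ m, (christoffel g l i m x * christoffel g m j k x
      - christoffel g l j m x * christoffel g m i k x)

/-- The Ricci tensor `Ric_{kj} = ∑_i R^i_{kij}`, the trace of `X ↦ R(X, ∂_j) ∂_k`. -/
def ricciCurvature (g : EuclideanSpace ℝ (Fin N) → Matrix (Fin N) (Fin N) ℝ)
    (k j : Fin N) (x : EuclideanSpace ℝ (Fin N)) : ℝ :=
  ∑ i, riemannCurvature g i k i j x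

/-- The scalar curvature `R_g = ∑_{k,j} g^{kj} Ric_{kj}`. -/
def scalarCurvature (g : EuclideanSpace ℝ (Fin N) → Matrix (Fin N) (Fin N) ℝ)
    (x : EuclideanSpace ℝ (Fin N)) : ℝ :=
  ∑ k, ∑ j, (g x)⁻¹ k j * ricciCurvature g k j x

/-- The Riemannian volume `dvol_g = √(det g) dx` on `Ω`. -/
def volumeOn (g : EuclideanSpace ℝ (Fin N) → Matrix (Fin N) (Fin N) ℝ)
    (Ω : Set (EuclideanSpace ℝ (Fin N))) : Measure (EuclideanSpace ℝ (Fin N)) :=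
  (volume.restrict Ω).withDensity (fun x => ENNReal.ofReal (Real.sqrt (g x).det))

/-- The inner product `⟨a, b⟩_g = ∑_{i,j} g^{ij} a_i b_j` of covectors at `x`. -/
def coInner (g : EuclideanSpace ℝ (Fin N) → Matrix (Fin N) (Fin N) ℝ)
    (x : EuclideanSpace ℝ (Fin N)) (a b : Fin N → ℝ) : ℝ :=
  ∑ i, ∑ j, (g x)⁻¹ i j * a i * b j

/-- The differential `df` in coordinates. -/
def differential (f : EuclideanSpace ℝ (Fin N) → ℝ) (x : EuclideanSpace ℝ (Fin N)) : Fin N → ℝ :=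
  fun i => pderiv i f x

/-! ### The weighted Dirichlet eigenvalue problem -/

/-- `f ∈ C_c^∞(Ω)`. -/
structure IsTestFunction (Ω : Set (EuclideanSpace ℝ (Fin N)))
    (f : EuclideanSpace ℝ (Fin N) → ℝ) : Prop where
  smooth : ContDiff ℝ ∞ f
  compact : HasCompactSupport f
  support : tsupport f ⊆ Ω

/-- `u ∈ H^1_0(Ω, g)` with weak differential `w`: the pair `(u, w)` is the limit of pairs `(f, df)`,
`f ∈ C_c^∞(Ω)`, in the norm `(∫_Ω u² + |w|_g² dvol_g)^{1/2}`. -/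
structure HasWeakDifferentialH10 (g : EuclideanSpace ℝ (Fin N) → Matrix (Fin N) (Fin N) ℝ)
    (Ω : Set (EuclideanSpace ℝ (Fin N))) (u : EuclideanSpace ℝ (Fin N) → ℝ)
    (w : EuclideanSpace ℝ (Fin N) → Fin N → ℝ) : Prop where
  aesm : AEStronglyMeasurable u (volumeOn g Ω)
  aesm_diff : AEStronglyMeasurable w (volumeOn g Ω)
  approx : ∃ f : ℕ → EuclideanSpace ℝ (Fin N) → ℝ, (∀ n, IsTestFunction Ω (f n)) ∧
    Tendsto (fun n => ∫⁻ x, ENNReal.ofReal ((u x - f n x) ^ 2) ∂(volumeOn g Ω)) atTop (𝓝 0) ∧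
    Tendsto (fun n => ∫⁻ x, ENNReal.ofReal
      (coInner g x (w x - differential (f n) x) (w x - differential (f n) x)) ∂(volumeOn g Ω))
      atTop (𝓝 0)

/-- `u` is a weak solution of `-Δ_g u = s ρ u` in `Ω`, `u = 0` on `∂Ω`: it lies in `H^1_0(Ω, g)` and
`∫_Ω ⟨du, dv⟩_g dvol_g = s ∫_Ω ρ u v dvol_g` for all `v ∈ C_c^∞(Ω)`. -/
def SolvesDirichlet (g : EuclideanSpace ℝ (Fin N) → Matrix (Fin N) (Fin N) ℝ)
    (ρ : EuclideanSpace ℝ (Fin N) → ℝ) (Ω : Set (EuclideanSpace ℝ (Fin N))) (s : ℝ)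
    (u : Lp ℝ 2 (volumeOn g Ω)) : Prop :=
  ∃ w : EuclideanSpace ℝ (Fin N) → Fin N → ℝ, HasWeakDifferentialH10 g Ω u w ∧
    ∀ v : EuclideanSpace ℝ (Fin N) → ℝ, IsTestFunction Ω v →
      ∫ x, coInner g x (w x) (differential v x) ∂(volumeOn g Ω)
        = s * ∫ x, ρ x * u x * v x ∂(volumeOn g Ω)

/-- The `k`-th Dirichlet eigenvalue `λ_k(Ω, Δ_g, ρ)` (`k = 1, 2, …`, repeated with multiplicity) of
`-Δ_g u = λ ρ u`: the least `t` such that there are `k` linearly independent eigenfunctions whose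
eigenvalues are at most `t`. -/
def dirichletEigenvalue (g : EuclideanSpace ℝ (Fin N) → Matrix (Fin N) (Fin N) ℝ)
    (ρ : EuclideanSpace ℝ (Fin N) → ℝ) (Ω : Set (EuclideanSpace ℝ (Fin N))) (k : ℕ) : ℝ :=
  sInf {t : ℝ | ∃ u : Fin k → Lp ℝ 2 (volumeOn g Ω), LinearIndependent ℝ u ∧
    ∀ i, ∃ s ≤ t, SolvesDirichlet g ρ Ω s (u i)}

/-- The fundamental gap `Γ(Ω, Δ_g, ρ) = λ_2(Ω, Δ_g, ρ) - λ_1(Ω, Δ_g, ρ)`. -/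
def fundamentalGap (g : EuclideanSpace ℝ (Fin N) → Matrix (Fin N) (Fin N) ℝ)
    (ρ : EuclideanSpace ℝ (Fin N) → ℝ) (Ω : Set (EuclideanSpace ℝ (Fin N))) : ℝ :=
  dirichletEigenvalue g ρ Ω 2 - dirichletEigenvalue g ρ Ω 1

/-- The oscillation `osc_Ω f = sup_Ω f - inf_Ω f`. -/
def osc (Ω : Set (EuclideanSpace ℝ (Fin N))) (f : EuclideanSpace ℝ (Fin N) → ℝ) : ℝ :=
  sSup (f '' Ω) - sInf (f '' Ω)

end DirichletGap

end

/-!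
Write `λ_k(φ, ρ)` for the eigenvalues of the metric `e^{2φ} g_E` with weight `ρ`. Two problems are
compared: the conformal one, `λ_k(φ, 1)`, and the weighted Euclidean one, `λ_k(0, e^{2φ})`. Both
are of the form "metric `e^{2φ} g_E`, weight `e^{2β}`" with `φ` and `β` bounded on `Ω`, which is
the setting `Admissible`.

*Conformal change of unknown.* The substitution `f ↦ F = e^{(N-2)φ/2} f` maps `C_c^∞(Ω)` onto
itself, carries the mass `∫ f² dvol_g` to the weighted Euclidean mass `∫ e^{2φ} F² dx`
(`mass_twist`), and after an integration by parts the energies differ by the potential of the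
conformal Laplacian (`energy_twist`):
`∫ |∇F|² dx = ∫ |df|_g² dvol_g + (N-2)/(4(N-1)) ∫ R_g e^{2φ} F² dx`.
The formula for `R_g` that enters here is `scalarCurvature_conformalMetric`. Hence if
`r ≤ R_g ≤ r'` on `Ω`, the Rayleigh quotient of `F` exceeds that of `f` by a number between `c r` and
`c r'`, where `c = (N-2)/(4(N-1))`.

*Variational characterization.* An eigenvalue is defined as an infimum over families of independent
weak eigenfunctions, and it has to be computed from Rayleigh quotients. `HasTrialSpace` says that
some `k`-dimensional space of test functions has energy less than `t` times mass. A trial space for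
`t` yields `k` independent eigenfunctions with eigenvalues at most `t`
(`Admissible.exists_eigenfunctions_of_hasTrialSpace`), and eigenfunctions with eigenvalues at most
`t` yield a trial space for every `t' > t` (`Admissible.hasTrialSpace_of_eigenfunctions`). For
this, `H^1_0(Ω)` is realized as a Hilbert space normed by mass plus energy, weak eigenfunctions are
the eigenvectors of the operator that represents the mass, and this operator is compact and
positive. The spectral input is `exists_linearIndependent_eigenvectors`, and compactness is
Rellich's theorem `exists_finite_discretization_energyBall`, obtained by averaging over small
balls; it needs no regularity of `∂Ω`, since functions in `H^1_0(Ω)` extend by zero.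

*Conclusion.* Transplanting trial spaces gives, for every `k ≥ 1`,
`λ_k(0, e^{2φ}) ≤ λ_k(φ, 1) + c r'` and `λ_k(φ, 1) ≤ λ_k(0, e^{2φ}) - c r`
(`dirichletEigenvalue_euclidean_le`, `dirichletEigenvalue_conformal_le`). The first for `k = 2` and
the second for `k = 1`, with `r'` and `r` the supremum and infimum of `R_g`, bound the difference
of the gaps. If `R_g` is constant then `r = r'`, and all eigenvalues are shifted by the same
amount.
-/

noncomputable section

namespace DirichletGap

open MeasureTheory Filter Topology

/-! ### Compact positive operators -/

section Spectral

variable {H : Type*} [NormedAddCommGroup H] [InnerProductSpace ℝ H]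

open scoped InnerProductSpace

/-- The norm of a compact positive operator is attained as an eigenvalue: otherwise it would lie in
the resolvent set, and the Rayleigh quotient would stay away from it. -/
theorem hasEigenvalue_norm_of_isCompactOperator [CompleteSpace H] {T : H →L[ℝ] H}
    (hT : IsCompactOperator T) (hsymm : T.IsSymmetric) (hpos : ∀ x, 0 ≤ ⟪T x, x⟫_ℝ) (h0 : T ≠ 0) :
    Module.End.HasEigenvalue (T : Module.End ℝ H) ‖T‖ := by
  have hn : ‖T‖ ≠ 0 := norm_ne_zero_iff.2 h0
  have : Nontrivial H := by
    by_contra h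
    rw [not_nontrivial_iff_subsingleton] at h
    exact h0 (ContinuousLinearMap.ext fun x => Subsingleton.elim _ _)
  refine (hT.hasEigenvalue_or_mem_resolventSet hn).resolve_right fun hres => ?_
  obtain ⟨ε, hε, h⟩ := T.rayleighQuotient_le_of_norm_mem_resolventSet (by simpa using hres)
  have hle : ‖T‖ ≤ ‖T‖ - ε := by
    conv_lhs => rw [T.norm_eq_iSup_rayleighQuotient hsymm]
    refine ciSup_le fun x => ?_
    rw [abs_of_nonneg]
    · exact h x
    · exact div_nonneg (by simpa [ContinuousLinearMap.reApplyInnerSelf] using hpos x) (sq_nonneg _)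
  linarith

/-- If the quadratic form of a compact positive operator exceeds `ν₀ ‖·‖²` on a `k`-dimensional
space, then there are `k` independent eigenvectors with eigenvalues at least `ν₀`. Otherwise the
span `E` of all such eigenvectors has dimension below `k`, some nonzero vector of the given space
is orthogonal to `E`, and on `Eᗮ` the operator has norm at most `ν₀`. -/
theorem exists_linearIndependent_eigenvectors [CompleteSpace H] {T : H →L[ℝ] H}
    (hT : IsCompactOperator T) (hsymm : T.IsSymmetric) (hpos : ∀ x, 0 ≤ ⟪T x, x⟫_ℝ) {ν₀ : ℝ}
    (hν₀ : 0 < ν₀) {k : ℕ} (w : Fin k → H)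
    (hw : ∀ c : Fin k → ℝ, c ≠ 0 →
      ν₀ * ‖∑ i, c i • w i‖ ^ 2 < ⟪T (∑ i, c i • w i), ∑ i, c i • w i⟫_ℝ) :
    ∃ x : Fin k → H, LinearIndependent ℝ x ∧ ∀ i, ∃ ν, ν₀ ≤ ν ∧ T (x i) = ν • x i := by
  classical
  let S : Set H := {x | ∃ ν, ν₀ ≤ ν ∧ T x = ν • x}
  obtain ⟨b, hbS, hspan, hli⟩ := exists_linearIndependent ℝ S
  by_cases hk : (k : Cardinal) ≤ Cardinal.mk b
  · have hk' : Cardinal.lift (Cardinal.mk (Fin k)) ≤ Cardinal.lift.{0} (Cardinal.mk b) := by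
      simpa using hk
    obtain ⟨e⟩ := Cardinal.lift_mk_le'.1 hk'
    exact ⟨fun i => (e i : H), hli.comp _ e.injective, fun i => hbS (e i).2⟩
  exfalso
  have hfin : Cardinal.mk b < k := not_le.1 hk
  have hbfin : b.Finite := Cardinal.lt_aleph0_iff_set_finite.1
    (hfin.trans (Cardinal.natCast_lt_aleph0))
  have : Fintype b := hbfin.fintype
  have hcard : Fintype.card b < k := by
    rw [Cardinal.mk_fintype] at hfin; exact_mod_cast hfin
  let E : Submodule ℝ H := Submodule.span ℝ S
  have hEb : Submodule.span ℝ b = E := hspan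
  have hEfd : FiniteDimensional ℝ E := hEb ▸ FiniteDimensional.span_of_finite ℝ hbfin
  have hrank : Module.finrank ℝ E < k := by
    rw [← hEb]
    refine lt_of_le_of_lt (finrank_span_le_card b) ?_
    simpa [Set.toFinset_card] using hcard
  -- a combination of the `w i` orthogonal to `E`
  let P : (Fin k → ℝ) →ₗ[ℝ] E :=
    (E.orthogonalProjectionOnto : H →ₗ[ℝ] E).comp (Fintype.linearCombination ℝ w)
  have hker : P.ker ≠ ⊥ := LinearMap.ker_ne_bot_of_finrank_lt (by simpa using hrank)
  obtain ⟨c, hcP, hc0⟩ := (Submodule.ne_bot_iff _).1 hker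
  set z : H := ∑ i, c i • w i with hz
  have hzE : z ∈ Eᗮ := by
    rw [← Submodule.orthogonalProjectionOnto_eq_zero_iff]
    have h : E.orthogonalProjectionOnto (Fintype.linearCombination ℝ w c) = 0 := hcP
    rwa [Fintype.linearCombination_apply] at h
  have hinvE : ∀ v ∈ E, T v ∈ E := by
    intro v hv
    induction hv using Submodule.span_induction with
    | mem x hx =>
      obtain ⟨ν, hν, h⟩ := hx
      rw [h]
      exact E.smul_mem _ (Submodule.subset_span ⟨ν, hν, h⟩)
    | zero => simp
    | add x y _ _ hx hy => rw [map_add]; exact E.add_mem hx hy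
    | smul a x _ hx => rw [map_smul]; exact E.smul_mem _ hx
  have hinv : ∀ v ∈ Eᗮ, T v ∈ Eᗮ := by
    intro v hv u hu
    have h1 := hsymm u v
    simp only [ContinuousLinearMap.coe_coe] at h1
    rw [← h1]
    exact hv _ (hinvE u hu)
  let R : Eᗮ →L[ℝ] Eᗮ := T.restrict hinv
  have hRc : IsCompactOperator R := hT.restrict' hinv
  have hRs : R.IsSymmetric := LinearMap.IsSymmetric.restrict_invariant hsymm hinv
  have hRp : ∀ x, 0 ≤ ⟪R x, x⟫_ℝ := fun x => hpos x
  have hRn : ‖R‖ ≤ ν₀ := by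
    by_contra! hlt
    have hR0 : R ≠ 0 := by
      intro h
      have : ‖R‖ = 0 := by rw [h]; exact ContinuousLinearMap.opNorm_zero
      linarith
    obtain ⟨v, hv⟩ :=
      (hasEigenvalue_norm_of_isCompactOperator hRc hRs hRp hR0).exists_hasEigenvector
    have hv1 : T (v : H) = ‖R‖ • (v : H) := congrArg Subtype.val hv.apply_eq_smul
    have hvE : (v : H) ∈ E := Submodule.subset_span ⟨_, hlt.le, hv1⟩
    have : (v : H) = 0 := inner_self_eq_zero (𝕜 := ℝ).1 (v.2 _ hvE)
    exact hv.2 (Subtype.ext this)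
  have h1 : ⟪R ⟨z, hzE⟩, ⟨z, hzE⟩⟫_ℝ ≤ ν₀ * ‖z‖ ^ 2 := by
    refine (real_inner_le_norm _ _).trans ?_
    have := R.le_opNorm ⟨z, hzE⟩
    have h2 : ‖(⟨z, hzE⟩ : Eᗮ)‖ = ‖z‖ := rfl
    rw [h2] at this ⊢
    nlinarith [norm_nonneg z, mul_le_mul_of_nonneg_right hRn (norm_nonneg z)]
  exact absurd (hw c hc0) (not_lt.2 h1)

/-- On the span of eigenvectors with eigenvalues at least `ν₀` the quadratic form of a symmetric
operator is at least `ν₀ ‖·‖²`: as eigenvectors for distinct eigenvalues are orthogonal, the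
difference is `‖∑ √(νᵢ - ν₀) cᵢ xᵢ‖²`. -/
theorem le_inner_of_eigenvectors {T : H →L[ℝ] H} (hsymm : T.IsSymmetric) {ν₀ : ℝ} {k : ℕ}
    {x : Fin k → H} {ν : Fin k → ℝ} (hν : ∀ i, ν₀ ≤ ν i) (hx : ∀ i, T (x i) = ν i • x i)
    (c : Fin k → ℝ) :
    ν₀ * ‖∑ i, c i • x i‖ ^ 2 ≤ ⟪T (∑ i, c i • x i), ∑ i, c i • x i⟫_ℝ := by
  have hort : ∀ i j, ν i ≠ ν j → ⟪x i, x j⟫_ℝ = 0 := by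
    intro i j hij
    have h := hsymm (x i) (x j)
    simp only [ContinuousLinearMap.coe_coe, hx, real_inner_smul_left, real_inner_smul_right] at h
    have : (ν i - ν j) * ⟪x i, x j⟫_ℝ = 0 := by linarith
    exact (mul_eq_zero.1 this).resolve_left (sub_ne_zero.2 hij)
  have key : ⟪T (∑ i, c i • x i), ∑ i, c i • x i⟫_ℝ - ν₀ * ‖∑ i, c i • x i‖ ^ 2 =
      ‖∑ i, (Real.sqrt (ν i - ν₀) * c i) • x i‖ ^ 2 := by
    rw [← real_inner_self_eq_norm_sq, ← real_inner_self_eq_norm_sq]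
    simp only [map_sum, map_smul, hx, sum_inner, inner_sum, real_inner_smul_left,
      real_inner_smul_right, Finset.mul_sum]
    rw [← Finset.sum_sub_distrib]
    refine Finset.sum_congr rfl fun i _ => ?_
    rw [← Finset.sum_sub_distrib]
    refine Finset.sum_congr rfl fun j _ => ?_
    by_cases hij : ν j = ν i
    · rw [hij]
      have := Real.mul_self_sqrt (sub_nonneg.2 (hν i))
      linear_combination (-(c i * c j * ⟪x j, x i⟫_ℝ)) * this
    · rw [hort j i hij]; ring
  nlinarith [sq_nonneg ‖∑ i, (Real.sqrt (ν i - ν₀) * c i) • x i‖]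

end Spectral

/-! ### Hilbert sums of two spaces -/

/-- The Hilbert sum of two inner product spaces. It is kept apart from `WithLp 2 (F × G)` so that
its algebraic structure comes from its norm alone. -/
def HilbertProd (F G : Type*) : Type _ := WithLp 2 (F × G)

namespace HilbertProd

open scoped InnerProductSpace

variable {F G : Type*} [NormedAddCommGroup F] [InnerProductSpace ℝ F] [NormedAddCommGroup G]
  [InnerProductSpace ℝ G]

instance : NormedAddCommGroup (HilbertProd F G) :=
  inferInstanceAs (NormedAddCommGroup (WithLp 2 (F × G)))

instance : InnerProductSpace ℝ (HilbertProd F G) :=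
  inferInstanceAs (InnerProductSpace ℝ (WithLp 2 (F × G)))

instance [CompleteSpace F] [CompleteSpace G] : CompleteSpace (HilbertProd F G) :=
  inferInstanceAs (CompleteSpace (WithLp 2 (F × G)))

/-- The first projection. -/
def fst : HilbertProd F G →L[ℝ] F := WithLp.fstL 2 ℝ F G

/-- The second projection. -/
def snd : HilbertProd F G →L[ℝ] G := WithLp.sndL 2 ℝ F G

/-- The pairing map. -/
def mk : F × G →L[ℝ] HilbertProd F G :=
  ((WithLp.prodContinuousLinearEquiv 2 ℝ F G).symm : F × G →L[ℝ] WithLp 2 (F × G))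

theorem inner_eq (x y : HilbertProd F G) : ⟪x, y⟫_ℝ = ⟪fst x, fst y⟫_ℝ + ⟪snd x, snd y⟫_ℝ :=
  WithLp.prod_inner_apply (𝕜 := ℝ) (E := F) (F := G) x y

theorem norm_sq_eq (x : HilbertProd F G) : ‖x‖ ^ 2 = ‖fst x‖ ^ 2 + ‖snd x‖ ^ 2 := by
  simp only [← real_inner_self_eq_norm_sq, inner_eq]

theorem tendsto_fst {α : Type*} {l : Filter α} {f : α → HilbertProd F G} {x : HilbertProd F G}
    (hf : Tendsto f l (𝓝 x)) : Tendsto (fun n => fst (f n)) l (𝓝 (fst x)) :=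
  ((fst : HilbertProd F G →L[ℝ] F).continuous.tendsto x).comp hf

theorem tendsto_snd {α : Type*} {l : Filter α} {f : α → HilbertProd F G} {x : HilbertProd F G}
    (hf : Tendsto f l (𝓝 x)) : Tendsto (fun n => snd (f n)) l (𝓝 (snd x)) :=
  ((snd : HilbertProd F G →L[ℝ] G).continuous.tendsto x).comp hf

end HilbertProd

/-! ### Eigenvalue problems for a pair of quadratic forms -/

section FormPair

open scoped InnerProductSpace

variable {D F : Type*} [NormedAddCommGroup D] [InnerProductSpace ℝ D] [CompleteSpace D]
  [NormedAddCommGroup F] [InnerProductSpace ℝ F] [CompleteSpace F]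

/-- For a map `ι : D → F` of Hilbert spaces, the operator on `D` that represents the form
`⟪ι x, ι y⟫`. Here `D` is a form domain, normed by mass plus energy, and `‖ι x‖²` is the mass. -/
def massOperator (ι : D →L[ℝ] F) : D →L[ℝ] D :=
  (ContinuousLinearMap.adjoint ι).comp ι

variable (ι : D →L[ℝ] F)

theorem inner_massOperator (x y : D) : ⟪massOperator ι x, y⟫_ℝ = ⟪ι x, ι y⟫_ℝ :=
  ContinuousLinearMap.adjoint_inner_left ι y (ι x)

theorem inner_massOperator_self (x : D) : ⟪massOperator ι x, x⟫_ℝ = ‖ι x‖ ^ 2 := by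
  rw [inner_massOperator, real_inner_self_eq_norm_sq]

theorem isSymmetric_massOperator : (massOperator ι).IsSymmetric := by
  intro x y
  simp only [ContinuousLinearMap.coe_coe]
  rw [inner_massOperator, real_inner_comm, ← inner_massOperator, real_inner_comm]

/-- The weak eigenvalue equation `energy = s · mass`, with the mass added to both sides and tested
on a dense subspace only, is an eigenvalue equation for the mass operator. -/
theorem eq_smul_massOperator_iff {V : Type*} {J : V → D} (hJ : DenseRange J) (x : D) (s : ℝ) :
    x = (s + 1) • massOperator ι x ↔ ∀ v : V, ⟪x, J v⟫_ℝ = (s + 1) * ⟪ι x, ι (J v)⟫_ℝ := by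
  have key : ∀ y : D, ⟪(s + 1) • massOperator ι x, y⟫_ℝ = (s + 1) * ⟪ι x, ι y⟫_ℝ := fun y => by
    rw [real_inner_smul_left, inner_massOperator]
  simp only [← key]
  refine ⟨fun hx v => by rw [← hx], fun hx => ext_inner_right ℝ fun y => ?_⟩
  exact congrFun (hJ.equalizer (by fun_prop) (by fun_prop) (funext hx)) y

/-- A `k`-dimensional space of trial vectors on which the energy is less than `t` times the mass
forces `k` independent eigenvectors with eigenvalues at most `t`. -/
theorem exists_eigenvectors_of_trial (hι : IsCompactOperator ι) {k : ℕ} {t : ℝ}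
    (ht : 0 < t + 1) (w : Fin k → D)
    (hw : ∀ c : Fin k → ℝ, c ≠ 0 → ‖∑ i, c i • w i‖ ^ 2 < (t + 1) * ‖ι (∑ i, c i • w i)‖ ^ 2) :
    ∃ x : Fin k → D, LinearIndependent ℝ (fun i => ι (x i)) ∧
      ∀ i, ∃ s ≤ t, x i = (s + 1) • massOperator ι (x i) := by
  have hν₀ : 0 < (t + 1)⁻¹ := inv_pos.2 ht
  obtain ⟨x, hli, hx⟩ := exists_linearIndependent_eigenvectors (T := massOperator ι)
    (hι.clm_comp (ContinuousLinearMap.adjoint ι)) (isSymmetric_massOperator ι)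
    (fun x => by rw [inner_massOperator_self]; positivity) hν₀ w (by
      intro c hc
      rw [inner_massOperator_self, inv_mul_lt_iff₀ ht]
      exact hw c hc)
  choose ν hν hTx using hx
  have hνpos : ∀ i, 0 < ν i := fun i => hν₀.trans_le (hν i)
  refine ⟨x, ?_, fun i => ⟨(ν i)⁻¹ - 1, ?_, ?_⟩⟩
  · have h1 : LinearIndependent ℝ (fun i => massOperator ι (x i)) := by
      have := hli.units_smul fun i => Units.mk0 (ν i) (hνpos i).ne'
      convert this using 1
      funext i
      exact hTx i
    exact LinearIndependent.of_comp (ContinuousLinearMap.adjoint ι : F →ₗ[ℝ] D) h1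
  · have := inv_anti₀ hν₀ (hν i)
    rw [inv_inv] at this
    linarith
  · rw [hTx, smul_smul, sub_add_cancel, inv_mul_cancel₀ (hνpos i).ne', one_smul]

/-- Conversely, near the span of `k` independent eigenvectors with eigenvalues at most `t` there is
a `k`-dimensional space of trial vectors from a dense subspace on which the energy is less than `t'`
times the mass, for any `t' > t`: the inequality is open in the vectors, uniformly over the unit
sphere of coefficients. -/
theorem exists_trial_of_eigenvectors {V : Type*} {J : V → D} (hJ : DenseRange J) {k : ℕ}
    (hk : 0 < k) {t t' : ℝ} (htt' : t < t')
    (x : Fin k → D) (hli : LinearIndependent ℝ (fun i => ι (x i)))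
    (hx : ∀ i, ∃ s ≤ t, x i = (s + 1) • massOperator ι (x i)) :
    ∃ f : Fin k → V, ∀ c : Fin k → ℝ, c ≠ 0 →
      ‖∑ i, c i • J (f i)‖ ^ 2 < (t' + 1) * ‖ι (∑ i, c i • J (f i))‖ ^ 2 := by
  choose s hst hs using hx
  have hxli : LinearIndependent ℝ x := LinearIndependent.of_comp (ι : D →ₗ[ℝ] F) hli
  have hspos : ∀ i, 0 < s i + 1 := by
    intro i
    have h1 : ‖x i‖ ^ 2 = (s i + 1) * ‖ι (x i)‖ ^ 2 := by
      rw [← inner_massOperator_self, ← real_inner_smul_left, ← hs i, real_inner_self_eq_norm_sq]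
    have h2 : 0 < ‖x i‖ ^ 2 := by
      have := hxli.ne_zero i
      positivity
    rw [h1] at h2
    exact pos_of_mul_pos_left h2 (sq_nonneg _)
  have ht : 0 < t + 1 := (hspos ⟨0, hk⟩).trans_le (by linarith [hst ⟨0, hk⟩])
  let Q : D → ℝ := fun y => ‖y‖ ^ 2 - (t' + 1) * ‖ι y‖ ^ 2
  have hQc : Continuous Q := by fun_prop
  have hQx : ∀ c : Fin k → ℝ, c ≠ 0 → Q (∑ i, c i • x i) < 0 := by
    intro c hc
    set z : D := ∑ i, c i • x i with hz
    have hz0 : z ≠ 0 := fun h0 => hc (funext (Fintype.linearIndependent_iff.1 hxli c h0))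
    have h1 : (t + 1)⁻¹ * ‖z‖ ^ 2 ≤ ‖ι z‖ ^ 2 := by
      rw [← inner_massOperator_self]
      refine le_inner_of_eigenvectors (isSymmetric_massOperator ι)
        (ν := fun i => (s i + 1)⁻¹) (fun i => ?_) (fun i => ?_) c
      · exact inv_anti₀ (hspos i) (by linarith [hst i])
      · conv_rhs => rw [hs i]
        rw [smul_smul, inv_mul_cancel₀ (hspos i).ne', one_smul]
    rw [inv_mul_le_iff₀ ht] at h1
    have h2 : 0 < ‖z‖ ^ 2 := by positivity
    have h3 : 0 < ‖ι z‖ ^ 2 := by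
      by_contra! h3
      nlinarith
    simp only [Q]
    nlinarith
  have hopen : ∀ᶠ y in 𝓝 x, ∀ c ∈ Metric.sphere (0 : Fin k → ℝ) 1, Q (∑ i, c i • y i) < 0 := by
    refine (isCompact_sphere _ _).eventually_forall_of_forall_eventually fun c hc => ?_
    have hcont : Continuous fun p : (Fin k → D) × (Fin k → ℝ) =>
        Q (∑ i, p.2 i • p.1 i) := hQc.comp (by fun_prop)
    have hc0 : c ≠ 0 := by
      rintro rfl
      simp at hc
    exact hcont.continuousAt.eventually_lt continuousAt_const (hQx c hc0)
  have hdense : x ∈ closure (Set.univ.pi fun _ : Fin k => Set.range J) := by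
    rw [closure_pi_set]
    exact fun i _ => hJ (x i)
  obtain ⟨y, hyQ, hyJ⟩ := mem_closure_iff_nhds.1 hdense _ hopen
  choose f hf using fun i => hyJ i trivial
  refine ⟨f, fun c hc => ?_⟩
  -- both sides are quadratic in `c`, so it is enough to test `c / ‖c‖`
  have hcn : 0 < ‖c‖ := norm_pos_iff.2 hc
  have h1 := hyQ (‖c‖⁻¹ • c) (by simp [norm_smul, hcn.ne'])
  have h2 : ∑ i, (‖c‖⁻¹ • c) i • y i = ‖c‖⁻¹ • ∑ i, c i • J (f i) := by
    simp [Finset.smul_sum, smul_smul, ← hf]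
  rw [h2] at h1
  simp only [Q, map_smul, norm_smul, mul_pow] at h1
  have h3 : 0 < ‖‖c‖⁻¹‖ ^ 2 := pow_pos (norm_pos_iff.2 (inv_ne_zero hcn.ne')) 2
  by_contra! h4
  nlinarith [mul_le_mul_of_nonneg_left h4 h3.le]

end FormPair

/-! ### Rellich compactness -/

section Rellich

/-- Jensen's inequality for the square and a probability density `η`. -/
theorem sq_integral_mul_le {α : Type*} [MeasurableSpace α] {μ : Measure α} {η h : α → ℝ}
    (hη : ∀ x, 0 ≤ η x) (hη1 : ∫ x, η x ∂μ = 1) (hηi : Integrable η μ)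
    (hi : Integrable (fun x => η x * h x) μ) (hi2 : Integrable (fun x => η x * h x ^ 2) μ) :
    (∫ x, η x * h x ∂μ) ^ 2 ≤ ∫ x, η x * h x ^ 2 ∂μ := by
  set a := ∫ x, η x * h x ∂μ with ha
  have h0 : 0 ≤ ∫ x, η x * (h x - a) ^ 2 ∂μ :=
    integral_nonneg fun x => mul_nonneg (hη x) (sq_nonneg _)
  have h1 : ∫ x, η x * (h x - a) ^ 2 ∂μ =
      ∫ x, η x * h x ^ 2 ∂μ - (2 * a) * a + a ^ 2 := by
    have : (fun x => η x * (h x - a) ^ 2) =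
        fun x => η x * h x ^ 2 - (2 * a) * (η x * h x) + a ^ 2 * η x := by
      funext x; ring
    have hs : Integrable (fun x => η x * h x ^ 2 - (2 * a) * (η x * h x)) μ :=
      hi2.sub (hi.const_mul _)
    rw [this, integral_add hs (hηi.const_mul _), integral_sub hi2 (hi.const_mul _),
      integral_const_mul, integral_const_mul, hη1, ← ha]
    ring
  rw [h1] at h0
  nlinarith

variable {E : Type*} [NormedAddCommGroup E] [InnerProductSpace ℝ E]

/-- A finite difference is the average of the derivative along the segment, so that its square is
at most the average of the squares. -/
theorem sq_sub_translate_le {f : E → ℝ} (hf : ContDiff ℝ 1 f) (x z : E) :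
    (f (x + z) - f x) ^ 2 ≤ ∫ t in Set.Ioc (0 : ℝ) 1, ‖fderiv ℝ f (x + t • z)‖ ^ 2 * ‖z‖ ^ 2 := by
  have hD : Continuous (fderiv ℝ f) := hf.continuous_fderiv one_ne_zero
  have hc : Continuous fun t : ℝ => fderiv ℝ f (x + t • z) z := by fun_prop
  have hc2 : Continuous fun t : ℝ => ‖fderiv ℝ f (x + t • z)‖ ^ 2 * ‖z‖ ^ 2 := by fun_prop
  have hint : ∀ {g : ℝ → ℝ}, Continuous g → IntegrableOn g (Set.Ioc 0 1) := fun hg =>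
    (hg.integrableOn_Icc (a := 0) (b := 1)).mono_set Set.Ioc_subset_Icc_self
  have h1 : f (x + z) - f x = ∫ t in Set.Ioc (0 : ℝ) 1, fderiv ℝ f (x + t • z) z := by
    rw [← intervalIntegral.integral_of_le zero_le_one,
      intervalIntegral.integral_eq_sub_of_hasDerivAt (f := fun t : ℝ => f (x + t • z))]
    · simp
    · intro t _
      have hd : HasDerivAt (fun t : ℝ => x + t • z) z t := by
        simpa using ((hasDerivAt_id t).smul_const z).const_add x
      exact ((hf.differentiable one_ne_zero _).hasFDerivAt).comp_hasDerivAt t hd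
    · exact hc.intervalIntegrable _ _
  have h2 := sq_integral_mul_le (μ := volume.restrict (Set.Ioc (0 : ℝ) 1)) (η := fun _ => 1)
    (h := fun t => fderiv ℝ f (x + t • z) z) (fun _ => zero_le_one) (by simp)
    (hint continuous_const) (by simp only [one_mul]; exact hint hc)
    (by simp only [one_mul]; exact hint (hc.pow 2))
  simp only [one_mul] at h2
  rw [h1]
  refine h2.trans (integral_mono (hint (hc.pow 2)) (hint hc2) fun t => ?_)
  simp only
  rw [← mul_pow, sq_le_sq, abs_of_nonneg (by positivity : 0 ≤ ‖fderiv ℝ f (x + t • z)‖ * ‖z‖)]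
  exact (fderiv ℝ f (x + t • z)).le_opNorm z

variable [FiniteDimensional ℝ E] [MeasurableSpace E] [BorelSpace E]

theorem lintegral_sq_sub_translate_le {f : E → ℝ} (hf : ContDiff ℝ 1 f) (z : E) :
    ∫⁻ x, ENNReal.ofReal ((f (x + z) - f x) ^ 2) ≤
      ENNReal.ofReal (‖z‖ ^ 2) * ∫⁻ x, ENNReal.ofReal (‖fderiv ℝ f x‖ ^ 2) := by
  have hD : Continuous (fderiv ℝ f) := hf.continuous_fderiv one_ne_zero
  calc ∫⁻ x, ENNReal.ofReal ((f (x + z) - f x) ^ 2)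
      ≤ ∫⁻ x, ∫⁻ t in Set.Ioc (0 : ℝ) 1,
          ENNReal.ofReal (‖fderiv ℝ f (x + t • z)‖ ^ 2) * ENNReal.ofReal (‖z‖ ^ 2) := by
        refine lintegral_mono fun x => ?_
        refine (ENNReal.ofReal_le_ofReal (sq_sub_translate_le hf x z)).trans ?_
        have hc2 : Continuous fun t : ℝ => ‖fderiv ℝ f (x + t • z)‖ ^ 2 * ‖z‖ ^ 2 := by fun_prop
        rw [ofReal_integral_eq_lintegral_ofReal
          ((hc2.integrableOn_Icc (a := 0) (b := 1)).mono_set Set.Ioc_subset_Icc_self)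
          (ae_of_all _ fun t => by positivity)]
        refine le_of_eq (lintegral_congr fun t => ?_)
        rw [ENNReal.ofReal_mul (by positivity)]
    _ = ∫⁻ t in Set.Ioc (0 : ℝ) 1, ∫⁻ x,
          ENNReal.ofReal (‖fderiv ℝ f (x + t • z)‖ ^ 2) * ENNReal.ofReal (‖z‖ ^ 2) := by
        refine lintegral_lintegral_swap (Measurable.aemeasurable ?_)
        refine Measurable.mul_const (ENNReal.measurable_ofReal.comp ?_) _
        exact Continuous.measurable (by fun_prop)
    _ = ∫⁻ t in Set.Ioc (0 : ℝ) 1,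
          ENNReal.ofReal (‖z‖ ^ 2) * ∫⁻ x, ENNReal.ofReal (‖fderiv ℝ f x‖ ^ 2) := by
        refine lintegral_congr fun t => ?_
        rw [lintegral_mul_const' _ _ ENNReal.ofReal_ne_top, mul_comm,
          lintegral_add_right_eq_self (fun x => ENNReal.ofReal (‖fderiv ℝ f x‖ ^ 2))]
    _ = _ := by simp

/-- The average of `f` around `x` with density `η`. -/
def average (η f : E → ℝ) (x : E) : ℝ := ∫ y, η y * f (x + y)

theorem average_eq (η f : E → ℝ) (x : E) : average η f x = ∫ y, η (y - x) * f y := by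
  rw [average, ← integral_add_right_eq_self (fun y => η (y - x) * f y) x]
  simp [add_comm]

/-- Averaging at scale `r` moves `f` by at most `r ‖∇f‖` in `L²`. -/
theorem lintegral_sq_sub_average_le {f η : E → ℝ} (hf : ContDiff ℝ 1 f)
    (hηc : Continuous η) (hηs : HasCompactSupport η) (hη : ∀ x, 0 ≤ η x) (hη1 : ∫ x, η x = 1)
    {r : ℝ} (hr : ∀ x, η x ≠ 0 → ‖x‖ ≤ r) :
    ∫⁻ x, ENNReal.ofReal ((f x - average η f x) ^ 2) ≤
      ENNReal.ofReal (r ^ 2) * ∫⁻ x, ENNReal.ofReal (‖fderiv ℝ f x‖ ^ 2) := by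
  have hfc := hf.continuous
  have hint : ∀ {g : E → ℝ}, Continuous g → Integrable (fun y => η y * g y) := fun hg =>
    (hηc.mul hg).integrable_of_hasCompactSupport hηs.mul_right
  have hηi : Integrable η := hηc.integrable_of_hasCompactSupport hηs
  have hpt : ∀ x, (f x - average η f x) ^ 2 ≤ ∫ y, η y * (f (x + y) - f x) ^ 2 := by
    intro x
    have h1 : average η f x - f x = ∫ y, η y * (f (x + y) - f x) := by
      simp only [mul_sub]
      rw [integral_sub (hint (by fun_prop)) (hint continuous_const), integral_mul_const, hη1,
        one_mul, average]
    rw [← neg_sub (average η f x), neg_sq, h1]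
    exact sq_integral_mul_le hη hη1 hηi (hint (by fun_prop)) (hint (by fun_prop))
  calc ∫⁻ x, ENNReal.ofReal ((f x - average η f x) ^ 2)
      ≤ ∫⁻ x, ∫⁻ y, ENNReal.ofReal (η y) * ENNReal.ofReal ((f (x + y) - f x) ^ 2) := by
        refine lintegral_mono fun x => ?_
        refine (ENNReal.ofReal_le_ofReal (hpt x)).trans ?_
        rw [ofReal_integral_eq_lintegral_ofReal (hint (by fun_prop))
          (ae_of_all _ fun y => mul_nonneg (hη y) (sq_nonneg _))]
        exact le_of_eq (lintegral_congr fun y => ENNReal.ofReal_mul (hη y))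
    _ = ∫⁻ y, ∫⁻ x, ENNReal.ofReal (η y) * ENNReal.ofReal ((f (x + y) - f x) ^ 2) := by
        refine lintegral_lintegral_swap (Measurable.aemeasurable ?_)
        refine Measurable.mul (ENNReal.measurable_ofReal.comp ?_)
          (ENNReal.measurable_ofReal.comp ?_)
        · exact Continuous.measurable (by fun_prop)
        · exact Continuous.measurable (by fun_prop)
    _ ≤ ∫⁻ y, ENNReal.ofReal (η y) *
          (ENNReal.ofReal (r ^ 2) * ∫⁻ x, ENNReal.ofReal (‖fderiv ℝ f x‖ ^ 2)) := by
        refine lintegral_mono fun y => ?_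
        simp only
        rw [lintegral_const_mul' _ _ ENNReal.ofReal_ne_top]
        by_cases hy : η y = 0
        · simp [hy]
        refine mul_le_mul_right ((lintegral_sq_sub_translate_le hf y).trans ?_) _
        refine mul_le_mul_left (ENNReal.ofReal_le_ofReal ?_) _
        exact pow_le_pow_left₀ (norm_nonneg _) (hr y hy) 2
    _ = _ := by
        rw [lintegral_mul_const, ← ofReal_integral_eq_lintegral_ofReal hηi (ae_of_all _ hη), hη1]
        · simp
        · exact ENNReal.measurable_ofReal.comp hηc.measurable

theorem average_sub {η f g : E → ℝ} (hηc : Continuous η) (hηs : HasCompactSupport η)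
    (hf : Continuous f) (hg : Continuous g) (x : E) :
    average η (fun y => f y - g y) x = average η f x - average η g x := by
  simp only [average, mul_sub]
  exact integral_sub
    ((hηc.mul (by fun_prop)).integrable_of_hasCompactSupport hηs.mul_right)
    ((hηc.mul (by fun_prop)).integrable_of_hasCompactSupport hηs.mul_right)

theorem abs_average_sub_average_le {η f : E → ℝ} (hηc : Continuous η)
    {C : NNReal} (hC : LipschitzWith C η) (hf : Continuous f) (hfs : HasCompactSupport f)
    (x y : E) :
    |average η f x - average η f y| ≤ C * dist x y * ∫ z, |f z| := by
  have hi : ∀ x, Integrable (fun z => η (z - x) * f z) := fun x =>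
    ((hηc.comp (by fun_prop)).mul hf).integrable_of_hasCompactSupport hfs.mul_left
  rw [average_eq, average_eq, ← integral_sub (hi x) (hi y), ← integral_const_mul]
  refine (abs_integral_le_integral_abs).trans (integral_mono ((hi x).sub (hi y)).abs
    ((hf.integrable_of_hasCompactSupport hfs).abs.const_mul _) fun z => ?_)
  simp only
  rw [← sub_mul, abs_mul]
  refine mul_le_mul_of_nonneg_right ?_ (abs_nonneg _)
  have := hC.dist_le_mul (z - x) (z - y)
  rwa [Real.dist_eq, dist_sub_left] at this

theorem abs_average_le {η f : E → ℝ} {B : ℝ} (hB : ∀ x, |η x| ≤ B)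
    (hf : Continuous f) (hfs : HasCompactSupport f) (x : E) :
    |average η f x| ≤ B * ∫ z, |f z| := by
  rw [average_eq, ← integral_const_mul]
  refine (abs_integral_le_integral_abs).trans (integral_mono_of_nonneg
    (ae_of_all _ fun _ => abs_nonneg _)
    ((hf.integrable_of_hasCompactSupport hfs).abs.const_mul _) (ae_of_all _ fun z => ?_))
  simp only
  rw [abs_mul]
  exact mul_le_mul_of_nonneg_right (hB _) (abs_nonneg _)

/-- The functions in `C¹_c(Ω)` with `∫ f² ≤ K` and `∫ ‖Df‖² ≤ K`. -/
def energyBall (Ω : Set E) (K : ℝ) : Set (E → ℝ) :=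
  {f | ContDiff ℝ 1 f ∧ HasCompactSupport f ∧ tsupport f ⊆ Ω ∧ ∫ x, f x ^ 2 ≤ K ∧
    ∫ x, ‖fderiv ℝ f x‖ ^ 2 ≤ K}

omit [InnerProductSpace ℝ E] [FiniteDimensional ℝ E] in
theorem integrable_norm_sq {F : Type*} [NormedAddCommGroup F] {μ : Measure E}
    [IsFiniteMeasureOnCompacts μ] {u : E → F} (hu : Continuous u) (hus : HasCompactSupport u) :
    Integrable (fun x => ‖u x‖ ^ 2) μ := by
  refine (hu.norm.pow 2).integrable_of_hasCompactSupport (hus.norm.mono' fun x hx => ?_)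
  refine subset_closure ?_
  simpa using hx

theorem integral_abs_le_of_mem_energyBall {Ω : Set E} (hΩ : Bornology.IsBounded Ω) {K : ℝ}
    {f : E → ℝ} (hf : f ∈ energyBall Ω K) : ∫ x, |f x| ≤ volume.real (closure Ω) + K := by
  obtain ⟨hf1, hfs, hfΩ, hK, -⟩ := hf
  have hc : IsCompact (closure Ω) := hΩ.isCompact_closure
  have h2 : Integrable (fun x => f x ^ 2) :=
    by simpa using integrable_norm_sq (μ := volume) hf1.continuous hfs
  have h1 : Integrable ((closure Ω).indicator (fun _ => (1 : ℝ))) :=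
    (integrable_indicator_iff hc.measurableSet).2 (integrableOn_const hc.measure_lt_top.ne)
  calc ∫ x, |f x| ≤ ∫ x, ((closure Ω).indicator (fun _ => (1 : ℝ)) x + f x ^ 2) := by
        refine integral_mono (hf1.continuous.integrable_of_hasCompactSupport hfs).abs
          (h1.add h2) fun x => ?_
        by_cases hx : x ∈ closure Ω
        · simp only [Set.indicator_of_mem hx]
          rw [← sq_abs]
          nlinarith [sq_nonneg (|f x| - 1), abs_nonneg (f x)]
        · have : f x = 0 := image_eq_zero_of_notMem_tsupport fun h => hx (subset_closure (hfΩ h))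
          simp [this, hx]
    _ ≤ _ := by
        rw [integral_add h1 h2, integral_indicator hc.measurableSet]
        exact add_le_add (by simp) hK

theorem integral_norm_sub_sq_le {F : Type*} [NormedAddCommGroup F] {u v : E → F} {K : ℝ}
    (hu : Continuous u) (hv : Continuous v) (hus : HasCompactSupport u) (hvs : HasCompactSupport v)
    (h1 : ∫ x, ‖u x‖ ^ 2 ≤ K) (h2 : ∫ x, ‖v x‖ ^ 2 ≤ K) : ∫ x, ‖u x - v x‖ ^ 2 ≤ 4 * K := by
  have hu2 := integrable_norm_sq (μ := volume) hu hus
  have hv2 := integrable_norm_sq (μ := volume) hv hvs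
  calc ∫ x, ‖u x - v x‖ ^ 2 ≤ ∫ x, (2 * ‖u x‖ ^ 2 + 2 * ‖v x‖ ^ 2) := by
        refine integral_mono (integrable_norm_sq (hu.sub hv) (hus.sub hvs))
          ((hu2.const_mul 2).add (hv2.const_mul 2)) fun x => ?_
        simp only
        have := norm_sub_le (u x) (v x)
        nlinarith [norm_nonneg (u x - v x), sq_nonneg (‖u x‖ - ‖v x‖)]
    _ ≤ _ := by
        rw [integral_add (hu2.const_mul 2) (hv2.const_mul 2),
          integral_const_mul, integral_const_mul]
        linarith

theorem sub_mem_energyBall {Ω : Set E} {K : ℝ} {f g : E → ℝ} (hf : f ∈ energyBall Ω K)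
    (hg : g ∈ energyBall Ω K) : (fun x => f x - g x) ∈ energyBall Ω (4 * K) := by
  obtain ⟨hf1, hfs, hfΩ, hf2, hf3⟩ := hf
  obtain ⟨hg1, hgs, hgΩ, hg2, hg3⟩ := hg
  have hts : tsupport (fun x => f x - g x) ⊆ tsupport f ∪ tsupport g := by
    exact tsupport_sub f g
  refine ⟨hf1.sub hg1, hfs.sub hgs, hts.trans (Set.union_subset hfΩ hgΩ), ?_, ?_⟩
  · simpa using integral_norm_sub_sq_le hf1.continuous hg1.continuous hfs hgs (by simpa using hf2)
      (by simpa using hg2)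
  · have : ∀ x, fderiv ℝ (fun x => f x - g x) x = fderiv ℝ f x - fderiv ℝ g x := fun x =>
      fderiv_fun_sub (hf1.differentiable one_ne_zero x) (hg1.differentiable one_ne_zero x)
    simp only [this]
    exact integral_norm_sub_sq_le (hf1.continuous_fderiv one_ne_zero)
      (hg1.continuous_fderiv one_ne_zero) (hfs.fderiv ℝ) (hgs.fderiv ℝ) hf3 hg3

/-- An element of the energy ball is small in `L²` once its averages are small at the points of a
net: averaging changes it little, and the averages are uniformly Lipschitz. -/
theorem integral_sq_le_of_average_le {Ω : Set E} (hΩ : Bornology.IsBounded Ω) {K : ℝ} {h η : E → ℝ}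
    (hh : h ∈ energyBall Ω K) (hηc : Continuous η) (hηs : HasCompactSupport η)
    (hη : ∀ x, 0 ≤ η x) (hη1 : ∫ x, η x = 1)
    {r : ℝ} (hr : ∀ x, η x ≠ 0 → ‖x‖ ≤ r) {b : ℝ} (hb : ∀ x ∈ closure Ω, |average η h x| ≤ b) :
    ∫ x, h x ^ 2 ≤ 2 * r ^ 2 * K + 2 * b ^ 2 * volume.real (closure Ω) := by
  obtain ⟨hh1, hhs, hhΩ, hK, hK'⟩ := hh
  have hc : IsCompact (closure Ω) := hΩ.isCompact_closure
  have h2 : Integrable (fun x => h x ^ 2) :=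
    by simpa using integrable_norm_sq (μ := volume) hh1.continuous hhs
  have hD : Integrable (fun x => ‖fderiv ℝ h x‖ ^ 2) :=
    integrable_norm_sq (hh1.continuous_fderiv one_ne_zero) (hhs.fderiv ℝ)
  have hK0 : 0 ≤ K := (integral_nonneg fun x => sq_nonneg _).trans hK
  have hle : ∫⁻ x, ENNReal.ofReal (h x ^ 2) ≤
      2 * (∫⁻ x, ENNReal.ofReal ((h x - average η h x) ^ 2)) +
        ENNReal.ofReal (2 * b ^ 2) * volume (closure Ω) := by
    have e1 : 2 * ∫⁻ x, ENNReal.ofReal ((h x - average η h x) ^ 2) =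
        ∫⁻ x, 2 * ENNReal.ofReal ((h x - average η h x) ^ 2) :=
      (lintegral_const_mul' _ _ ENNReal.ofNat_ne_top).symm
    have e2 : ENNReal.ofReal (2 * b ^ 2) * volume (closure Ω) =
        ∫⁻ x, (closure Ω).indicator (fun _ => ENNReal.ofReal (2 * b ^ 2)) x :=
      (lintegral_indicator_const hc.measurableSet _).symm
    rw [e1, e2, ← lintegral_add_right _ (measurable_const.indicator hc.measurableSet)]
    refine lintegral_mono fun x => ?_
    by_cases hx : x ∈ closure Ω
    · simp only [Set.indicator_of_mem hx]
      rw [← ENNReal.ofReal_ofNat, ← ENNReal.ofReal_mul (by norm_num),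
        ← ENNReal.ofReal_add (by positivity) (by positivity)]
      refine ENNReal.ofReal_le_ofReal ?_
      have := sq_le_sq' (neg_le_of_abs_le (hb x hx)) (le_of_abs_le (hb x hx))
      nlinarith [sq_nonneg (h x - 2 * average η h x)]
    · have : h x = 0 := image_eq_zero_of_notMem_tsupport fun h' => hx (subset_closure (hhΩ h'))
      simp [this]
  have h3 := lintegral_sq_sub_average_le hh1 hηc hηs hη hη1 hr
  rw [← ofReal_integral_eq_lintegral_ofReal hD (ae_of_all _ fun _ => by positivity)] at h3
  rw [← ofReal_integral_eq_lintegral_ofReal h2 (ae_of_all _ fun _ => by positivity)] at hle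
  have h4 : ENNReal.ofReal (∫ x, h x ^ 2) ≤
      ENNReal.ofReal (2 * r ^ 2 * K + 2 * b ^ 2 * volume.real (closure Ω)) := by
    refine hle.trans ?_
    rw [ENNReal.ofReal_add (by positivity) (by positivity)]
    refine add_le_add ?_ ?_
    · rw [mul_assoc, ENNReal.ofReal_mul (by norm_num), ENNReal.ofReal_ofNat]
      refine mul_le_mul_right (h3.trans ?_) _
      rw [ENNReal.ofReal_mul (by positivity)]
      exact mul_le_mul_right (ENNReal.ofReal_le_ofReal hK') _
    · rw [ENNReal.ofReal_mul (p := 2 * b ^ 2) (by positivity),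
        ofReal_measureReal hc.measure_lt_top.ne]
  exact (ENNReal.ofReal_le_ofReal_iff (by positivity)).1 h4

/-- **Rellich's theorem** for a bounded set `Ω`, stated without reference to a function space: the
energy ball splits into finitely many classes of `L²`-diameter at most `√ε`. -/
theorem exists_finite_discretization_energyBall {Ω : Set E} (hΩ : Bornology.IsBounded Ω) {K ε : ℝ}
    (hK : 0 ≤ K) (hε : 0 < ε) :
    ∃ (β : Type) (_ : Fintype β) (F : energyBall Ω K → β), ∀ f g : energyBall Ω K, F f = F g →
      ∫ x, (f.1 x - g.1 x) ^ 2 ≤ ε := by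
  have hc : IsCompact (closure Ω) := hΩ.isCompact_closure
  set V := volume.real (closure Ω) with hV
  have hV0 : 0 ≤ V := measureReal_nonneg
  -- the averaging scale `r` and the accuracy `τ` of the averages
  obtain ⟨r, hr0, hr⟩ : ∃ r > 0, 2 * r ^ 2 * (4 * K) ≤ ε / 2 := by
    refine ⟨Real.sqrt (ε / (16 * (K + 1))), by positivity, ?_⟩
    rw [Real.sq_sqrt (by positivity), ← sub_nonneg]
    have : ε / 2 - 2 * (ε / (16 * (K + 1))) * (4 * K) = ε / (2 * (K + 1)) := by
      field_simp; ring
    rw [this]; positivity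
  obtain ⟨τ, hτ0, hτ⟩ : ∃ τ > 0, 2 * (2 * τ) ^ 2 * V ≤ ε / 2 := by
    refine ⟨Real.sqrt (ε / (16 * (V + 1))), by positivity, ?_⟩
    rw [mul_pow, Real.sq_sqrt (by positivity), ← sub_nonneg]
    have : ε / 2 - 2 * (2 ^ 2 * (ε / (16 * (V + 1)))) * V = ε / (2 * (V + 1)) := by
      field_simp; ring
    rw [this]; positivity
  let bump : ContDiffBump (0 : E) := ⟨r / 2, r, by positivity, by linarith⟩
  set η : E → ℝ := bump.normed volume with hη_def
  have hηd : ContDiff ℝ 1 η := bump.contDiff_normed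
  have hηc := hηd.continuous
  have hηs : HasCompactSupport η := bump.hasCompactSupport_normed
  have hη : ∀ x, 0 ≤ η x := fun x => bump.nonneg_normed x
  have hη1 : ∫ x, η x = 1 := bump.integral_normed
  have hηr : ∀ x, η x ≠ 0 → ‖x‖ ≤ r := by
    intro x hx
    have : x ∈ Function.support η := hx
    rw [hη_def, bump.support_normed_eq] at this
    simpa using (Metric.mem_ball.1 this).le
  obtain ⟨C, hC⟩ := hηd.lipschitzWith_of_hasCompactSupport hηs one_ne_zero
  obtain ⟨B, hB⟩ := hηs.exists_bound_of_continuous hηc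
  have hB0 : 0 ≤ B := (norm_nonneg _).trans (hB 0)
  obtain ⟨δ, hδ0, hδ⟩ : ∃ δ > 0, C * δ * (V + 4 * K) ≤ τ := by
    refine ⟨τ / (C * (V + 4 * K) + 1), by positivity, ?_⟩
    rw [← sub_nonneg]
    have : τ - C * (τ / (C * (V + 4 * K) + 1)) * (V + 4 * K) = τ / (C * (V + 4 * K) + 1) := by
      field_simp; ring
    rw [this]; positivity
  obtain ⟨net, -, hnet_fin, hnet⟩ := hc.finite_cover_balls hδ0
  have : Fintype net := hnet_fin.fintype
  obtain ⟨t, -, ht_fin, ht⟩ := (isCompact_closedBall (0 : net → ℝ) (B * (V + K))).finite_cover_balls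
    (half_pos hτ0)
  have hmem : ∀ f : energyBall Ω K,
      (fun p : net => average η f.1 p) ∈ Metric.closedBall (0 : net → ℝ) (B * (V + K)) := by
    intro f
    rw [mem_closedBall_zero_iff, pi_norm_le_iff_of_nonneg (by positivity)]
    intro p
    refine (abs_average_le hB f.2.1.continuous f.2.2.1 _).trans ?_
    exact mul_le_mul_of_nonneg_left (integral_abs_le_of_mem_energyBall hΩ f.2) hB0
  have hex : ∀ f : energyBall Ω K, ∃ c : t, dist (fun p : net => average η f.1 p) c < τ / 2 := by
    intro f
    obtain ⟨c, hct, hcd⟩ := Set.mem_iUnion₂.1 (ht (hmem f))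
    exact ⟨⟨c, hct⟩, hcd⟩
  choose F hF using hex
  have : Finite t := ht_fin
  -- the index type is moved to the lowest universe
  obtain ⟨n, ⟨e⟩⟩ := Finite.exists_equiv_fin t
  refine ⟨Fin n, inferInstance, fun f => e (F f), fun f g hfg => ?_⟩
  have hFfg : F f = F g := e.injective hfg
  have hd : dist (fun p : net => average η f.1 p) (fun p : net => average η g.1 p) < τ := by
    have h1 := hF f
    have h2 := hF g
    rw [hFfg] at h1
    linarith [dist_triangle_right (fun p : net => average η f.1 p)
      (fun p : net => average η g.1 p) (F g)]
  have hsub := sub_mem_energyBall f.2 g.2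
  have hb : ∀ x ∈ closure Ω, |average η (fun y => f.1 y - g.1 y) x| ≤ 2 * τ := by
    intro x hx
    obtain ⟨p, hp, hxp⟩ := Set.mem_iUnion₂.1 (hnet hx)
    have h1 := abs_average_sub_average_le hηc hC hsub.1.continuous hsub.2.1 x p
    have h2 : |average η (fun y => f.1 y - g.1 y) p| ≤ τ := by
      rw [average_sub hηc hηs f.2.1.continuous g.2.1.continuous]
      exact ((dist_le_pi_dist (fun p : net => average η f.1 p) _ ⟨p, hp⟩).trans_lt hd).le
    have h3 : C * dist x p * ∫ z, |f.1 z - g.1 z| ≤ τ := by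
      refine le_trans ?_ hδ
      exact mul_le_mul (mul_le_mul_of_nonneg_left (Metric.mem_ball.1 hxp).le C.2)
        (integral_abs_le_of_mem_energyBall hΩ hsub) (integral_nonneg fun _ => abs_nonneg _)
        (by positivity)
    have h4 := abs_sub_abs_le_abs_sub (average η (fun y => f.1 y - g.1 y) x)
      (average η (fun y => f.1 y - g.1 y) p)
    linarith
  have := integral_sq_le_of_average_le hΩ hsub hηc hηs hη hη1 hηr hb
  linarith

end Rellich

variable {N : ℕ}

/-! ### Conformally flat metrics on a relatively compact open set -/

/-- `Ω` is open and relatively compact, and `φ`, `β` are continuous up to its boundary. The metric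
is `e^{2φ} g_E` and the weight is `e^{2β}`. -/
structure Admissible (Ω : Set (EuclideanSpace ℝ (Fin N))) (φ β : EuclideanSpace ℝ (Fin N) → ℝ) :
    Prop where
  isOpen : IsOpen Ω
  isCompact : IsCompact (closure Ω)
  metric : ContinuousOn φ (closure Ω)
  weight : ContinuousOn β (closure Ω)

theorem euclideanMetric_eq_conformalMetric : euclideanMetric N = conformalMetric fun _ => 0 := by
  funext x
  simp [conformalMetric]

theorem conformalMetric_inv (φ : EuclideanSpace ℝ (Fin N) → ℝ) (x : EuclideanSpace ℝ (Fin N)) :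
    (conformalMetric φ x)⁻¹ = Real.exp (-(2 * φ x)) • (1 : Matrix (Fin N) (Fin N) ℝ) := by
  refine Matrix.inv_eq_right_inv ?_
  simp [conformalMetric, euclideanMetric, smul_smul, ← Real.exp_add]

theorem coInner_conformalMetric (φ : EuclideanSpace ℝ (Fin N) → ℝ)
    (x : EuclideanSpace ℝ (Fin N)) (a b : Fin N → ℝ) :
    coInner (conformalMetric φ) x a b = Real.exp (-(2 * φ x)) * ∑ i, a i * b i := by
  simp only [coInner, conformalMetric_inv, Matrix.smul_apply, Matrix.one_apply, smul_eq_mul,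
    Finset.mul_sum]
  refine Finset.sum_congr rfl fun i _ => ?_
  rw [Finset.sum_eq_single i (fun j _ hj => by simp [hj.symm]) (by simp)]
  simp [mul_assoc]

theorem sqrt_det_conformalMetric (φ : EuclideanSpace ℝ (Fin N) → ℝ)
    (x : EuclideanSpace ℝ (Fin N)) :
    Real.sqrt (conformalMetric φ x).det = Real.exp (N * φ x) := by
  rw [conformalMetric, euclideanMetric, Matrix.det_smul, Matrix.det_one, mul_one, Fintype.card_fin,
    ← Real.exp_nat_mul, show (N : ℝ) * (2 * φ x) = N * φ x + N * φ x by ring, Real.exp_add,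
    Real.sqrt_mul_self (Real.exp_pos _).le]

namespace Admissible

variable {Ω : Set (EuclideanSpace ℝ (Fin N))} {φ β : EuclideanSpace ℝ (Fin N) → ℝ}

theorem exists_bound (h : Admissible Ω φ β) : ∃ K, ∀ x ∈ Ω, |φ x| ≤ K ∧ |β x| ≤ K := by
  obtain ⟨K₁, h₁⟩ := h.isCompact.exists_bound_of_continuousOn h.metric
  obtain ⟨K₂, h₂⟩ := h.isCompact.exists_bound_of_continuousOn h.weight
  exact ⟨max K₁ K₂, fun x hx => ⟨(h₁ x (subset_closure hx)).trans (le_max_left _ _),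
    (h₂ x (subset_closure hx)).trans (le_max_right _ _)⟩⟩

theorem ae_mem (h : Admissible Ω φ β) : ∀ᵐ x ∂volumeOn (conformalMetric φ) Ω, x ∈ Ω :=
  (withDensity_absolutelyContinuous _ _).ae_le (ae_restrict_mem h.isOpen.measurableSet)

theorem volumeOn_le (h : Admissible Ω φ β) :
    ∃ C : NNReal, volumeOn (conformalMetric φ) Ω ≤ C • volume.restrict Ω := by
  obtain ⟨K, hK⟩ := h.exists_bound
  refine ⟨Real.toNNReal (Real.exp (N * K)), ?_⟩
  have : (Real.toNNReal (Real.exp (N * K)) : NNReal) • volume.restrict Ω =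
      (volume.restrict Ω).withDensity fun _ => ENNReal.ofReal (Real.exp (N * K)) := by
    rw [withDensity_const]; rfl
  rw [this]
  refine withDensity_mono ?_
  filter_upwards [ae_restrict_mem h.isOpen.measurableSet] with x hx
  rw [sqrt_det_conformalMetric]
  refine ENNReal.ofReal_le_ofReal (Real.exp_le_exp.2 ?_)
  exact mul_le_mul_of_nonneg_left (le_of_abs_le (hK x hx).1) (Nat.cast_nonneg _)

theorem aestronglyMeasurable (h : Admissible Ω φ β) {f : EuclideanSpace ℝ (Fin N) → ℝ}
    (hf : ContinuousOn f (closure Ω)) :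
    AEStronglyMeasurable f (volumeOn (conformalMetric φ) Ω) :=
  ((hf.mono subset_closure).aestronglyMeasurable h.isOpen.measurableSet).mono_ac
    (withDensity_absolutelyContinuous _ _)

theorem isFiniteMeasure (h : Admissible Ω φ β) :
    IsFiniteMeasure (volumeOn (conformalMetric φ) Ω) := by
  obtain ⟨C, hC⟩ := h.volumeOn_le
  refine ⟨(hC _).trans_lt ?_⟩
  have : volume Ω < ⊤ := (measure_mono subset_closure).trans_lt h.isCompact.measure_lt_top
  rw [Measure.smul_apply, Measure.restrict_apply_univ]
  exact ENNReal.mul_lt_top ENNReal.coe_lt_top this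

theorem integral_volumeOn (h : Admissible Ω φ β) (F : EuclideanSpace ℝ (Fin N) → ℝ) :
    ∫ x, F x ∂volumeOn (conformalMetric φ) Ω = ∫ x in Ω, Real.exp (N * φ x) * F x := by
  rw [volumeOn, integral_withDensity_eq_integral_toReal_smul₀]
  · simp [sqrt_det_conformalMetric, Real.exp_nonneg]
  · simp only [sqrt_det_conformalMetric]
    have hc : ContinuousOn (fun x => Real.exp (N * φ x)) Ω :=
      (h.metric.mono subset_closure).const_mul _ |>.rexp
    exact (hc.aemeasurable h.isOpen.measurableSet).ennreal_ofReal
  · exact ae_of_all _ fun x => ENNReal.ofReal_lt_top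

end Admissible

/-! ### Test functions and their quadratic forms -/

/-- The gradient as a vector of the Euclidean space. -/
def gradVec (f : EuclideanSpace ℝ (Fin N) → ℝ) (x : EuclideanSpace ℝ (Fin N)) :
    EuclideanSpace ℝ (Fin N) :=
  WithLp.toLp 2 (differential f x)

theorem continuous_gradVec {f : EuclideanSpace ℝ (Fin N) → ℝ} (hf : ContDiff ℝ ∞ f) :
    Continuous (gradVec f) := by
  have hD : Continuous (fderiv ℝ f) := hf.continuous_fderiv (by simp)
  refine (PiLp.continuous_toLp 2 _).comp (continuous_pi fun i => ?_)
  exact hD.clm_apply continuous_const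

theorem norm_fderiv_le_norm_gradVec (f : EuclideanSpace ℝ (Fin N) → ℝ)
    (x : EuclideanSpace ℝ (Fin N)) : ‖fderiv ℝ f x‖ ≤ ‖gradVec f x‖ := by
  refine ContinuousLinearMap.opNorm_le_bound _ (norm_nonneg _) fun v => ?_
  have : fderiv ℝ f x v = inner ℝ (gradVec f x) v := by
    conv_lhs => rw [← (EuclideanSpace.basisFun (Fin N) ℝ).sum_repr v]
    simp [PiLp.inner_apply, gradVec, differential, pderiv]
  rw [this]
  exact abs_real_inner_le_norm _ _

/-- The space `C_c^∞(Ω)`. -/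
def testSpace (Ω : Set (EuclideanSpace ℝ (Fin N))) :
    Submodule ℝ (EuclideanSpace ℝ (Fin N) → ℝ) where
  carrier := {f | IsTestFunction Ω f}
  zero_mem' := ⟨contDiff_const, HasCompactSupport.zero, by simp [tsupport]⟩
  add_mem' hf hg := ⟨hf.1.add hg.1, hf.2.add hg.2,
    (tsupport_add _ _).trans (Set.union_subset hf.3 hg.3)⟩
  smul_mem' c f hf := ⟨hf.1.const_smul c, hf.2.smul_left (f := fun _ => c),
    (closure_mono (Function.support_const_smul_subset c f)).trans hf.3⟩

theorem gradVec_add {Ω : Set (EuclideanSpace ℝ (Fin N))} (f g : testSpace Ω)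
    (x : EuclideanSpace ℝ (Fin N)) :
    gradVec (f.1 + g.1) x = gradVec f.1 x + gradVec g.1 x := by
  ext i
  simp [gradVec, differential, pderiv,
    fderiv_add (f.2.1.differentiable (by simp) x) (g.2.1.differentiable (by simp) x)]

theorem gradVec_smul {Ω : Set (EuclideanSpace ℝ (Fin N))} (c : ℝ) (f : testSpace Ω)
    (x : EuclideanSpace ℝ (Fin N)) : gradVec (c • f.1) x = c • gradVec f.1 x := by
  ext i
  simp [gradVec, differential, pderiv, fderiv_const_smul (f.2.1.differentiable (by simp) x)]

theorem gradVec_eq_zero {f : EuclideanSpace ℝ (Fin N) → ℝ} {x : EuclideanSpace ℝ (Fin N)}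
    (hx : x ∉ tsupport f) : gradVec f x = 0 := by
  ext i
  simp [gradVec, differential, pderiv, image_eq_zero_of_notMem_tsupport
    (fun h' => hx (tsupport_fderiv_subset ℝ h') : x ∉ tsupport (fderiv ℝ f))]

theorem hasCompactSupport_gradVec {f : EuclideanSpace ℝ (Fin N) → ℝ} (hf : HasCompactSupport f) :
    HasCompactSupport (gradVec f) :=
  hf.mono' fun _ hx => by_contra fun h => hx (gradVec_eq_zero h)

theorem tsupport_subset_of_eq_zero {E F G : Type*} [TopologicalSpace E] [Zero F] [Zero G]
    {f : E → F} {u : E → G} (hu : ∀ x, x ∉ tsupport f → u x = 0) : tsupport u ⊆ tsupport f :=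
  closure_minimal (fun x hx => by_contra fun h' => hx (hu x h')) (isClosed_tsupport f)

theorem hasCompactSupport_sq {Ω : Set (EuclideanSpace ℝ (Fin N))} (f : testSpace Ω) :
    HasCompactSupport fun x => f.1 x ^ 2 := by
  simpa [pow_two, Pi.mul_def] using f.2.2.mul_left (f := f.1)

theorem tsupport_sq_subset {Ω : Set (EuclideanSpace ℝ (Fin N))} (f : testSpace Ω) :
    tsupport (fun x => f.1 x ^ 2) ⊆ Ω :=
  (tsupport_subset_of_eq_zero fun x hx => by
    simp [image_eq_zero_of_notMem_tsupport hx]).trans f.2.3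

/-- The weighted mass `∫_Ω ρ f² dvol_g`. -/
def mass (g : EuclideanSpace ℝ (Fin N) → Matrix (Fin N) (Fin N) ℝ)
    (ρ : EuclideanSpace ℝ (Fin N) → ℝ) (Ω : Set (EuclideanSpace ℝ (Fin N)))
    (f : EuclideanSpace ℝ (Fin N) → ℝ) : ℝ :=
  ∫ x, ρ x * f x ^ 2 ∂volumeOn g Ω

/-- The Dirichlet energy `∫_Ω |df|_g² dvol_g`. -/
def energy (g : EuclideanSpace ℝ (Fin N) → Matrix (Fin N) (Fin N) ℝ)
    (Ω : Set (EuclideanSpace ℝ (Fin N))) (f : EuclideanSpace ℝ (Fin N) → ℝ) : ℝ :=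
  ∫ x, coInner g x (differential f x) (differential f x) ∂volumeOn g Ω

theorem coInner_conformalMetric_self (φ f : EuclideanSpace ℝ (Fin N) → ℝ)
    (x : EuclideanSpace ℝ (Fin N)) :
    coInner (conformalMetric φ) x (differential f x) (differential f x) =
      Real.exp (-(2 * φ x)) * ‖gradVec f x‖ ^ 2 := by
  rw [coInner_conformalMetric, EuclideanSpace.norm_sq_eq]
  simp [gradVec, pow_two]

theorem norm_toLp_two_sq {α E : Type*} [MeasurableSpace α] {μ : Measure α} [NormedAddCommGroup E]
    [InnerProductSpace ℝ E] {F : α → E} (hF : MemLp F 2 μ) :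
    ‖hF.toLp F‖ ^ 2 = ∫ x, ‖F x‖ ^ 2 ∂μ := by
  rw [← real_inner_self_eq_norm_sq, L2.inner_def]
  refine integral_congr_ae ?_
  filter_upwards [hF.coeFn_toLp] with x hx
  rw [hx, real_inner_self_eq_norm_sq]

theorem eLpNorm_two_eq_lintegral_rpow {α E : Type*} [MeasurableSpace α] {μ : Measure α}
    [NormedAddCommGroup E] (F : α → E) :
    eLpNorm F 2 μ = (∫⁻ x, ENNReal.ofReal (‖F x‖ ^ 2) ∂μ) ^ (1 / 2 : ℝ) := by
  rw [eLpNorm_eq_lintegral_rpow_enorm_toReal (by norm_num) (by norm_num)]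
  simp only [ENNReal.toReal_ofNat]
  congr 1
  refine lintegral_congr fun x => ?_
  rw [ENNReal.ofReal_pow (norm_nonneg _), ofReal_norm]
  exact ENNReal.rpow_two _

theorem tendsto_eLpNorm_two_iff {α E : Type*} [MeasurableSpace α] {μ : Measure α}
    [NormedAddCommGroup E] (F : ℕ → α → E) :
    Tendsto (fun n => eLpNorm (F n) 2 μ) atTop (𝓝 0) ↔
      Tendsto (fun n => ∫⁻ x, ENNReal.ofReal (‖F n x‖ ^ 2) ∂μ) atTop (𝓝 0) := by
  simp only [eLpNorm_two_eq_lintegral_rpow]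
  constructor <;> intro h
  · have h2 := h.ennrpow_const 2
    have e : ∀ a : ENNReal, (a ^ (1 / 2 : ℝ)) ^ (2 : ℝ) = a := fun a => by
      rw [← ENNReal.rpow_mul]; norm_num
    rw [ENNReal.zero_rpow_of_pos two_pos] at h2
    exact h2.congr fun n => e _
  · have h2 := h.ennrpow_const (1 / 2)
    simpa using h2

namespace Admissible

variable {Ω : Set (EuclideanSpace ℝ (Fin N))} {φ β : EuclideanSpace ℝ (Fin N) → ℝ}

theorem exists_integral_exp_mul_comparison (h : Admissible Ω φ β)
    {γ : EuclideanSpace ℝ (Fin N) → ℝ} (hγ : ContinuousOn γ (closure Ω)) :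
    ∃ K, 0 ≤ K ∧ ∀ G : EuclideanSpace ℝ (Fin N) → ℝ, Continuous G → HasCompactSupport G →
      tsupport G ⊆ Ω → (∀ x, 0 ≤ G x) →
      ∫ x, G x ≤ K * ∫ x in Ω, Real.exp (γ x) * G x ∧
        ∫ x in Ω, Real.exp (γ x) * G x ≤ K * ∫ x, G x := by
  obtain ⟨K, hK⟩ := h.isCompact.exists_bound_of_continuousOn hγ
  refine ⟨Real.exp K, (Real.exp_pos _).le, fun G hG hGs hGΩ hG0 => ?_⟩
  have hΩm := h.isOpen.measurableSet
  have hGi : Integrable G (volume.restrict Ω) :=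
    (hG.integrable_of_hasCompactSupport hGs).integrableOn
  have hγm : AEStronglyMeasurable (fun x => Real.exp (γ x)) (volume.restrict Ω) :=
    (hγ.mono subset_closure).rexp.aestronglyMeasurable hΩm
  have hb : ∀ᵐ x ∂volume.restrict Ω, |γ x| ≤ K := by
    filter_upwards [ae_restrict_mem hΩm] with x hx
    exact hK x (subset_closure hx)
  have hi : Integrable (fun x => Real.exp (γ x) * G x) (volume.restrict Ω) := by
    refine hGi.bdd_mul (c := Real.exp K) hγm ?_
    filter_upwards [hb] with x hx
    rw [Real.norm_eq_abs, Real.abs_exp]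
    exact Real.exp_le_exp.2 (le_of_abs_le hx)
  have heq : ∫ x, G x = ∫ x in Ω, G x := by
    rw [setIntegral_eq_integral_of_forall_compl_eq_zero]
    exact fun x hx => image_eq_zero_of_notMem_tsupport fun h' => hx (hGΩ h')
  rw [heq, ← integral_const_mul, ← integral_const_mul]
  constructor
  · refine integral_mono_ae hGi (hi.const_mul _) ?_
    filter_upwards [hb] with x hx
    rw [← mul_assoc, ← Real.exp_add]
    exact le_mul_of_one_le_left (hG0 x) (Real.one_le_exp (by linarith [neg_le_of_abs_le hx]))
  · refine integral_mono_ae hi (hGi.const_mul _) ?_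
    filter_upwards [hb] with x hx
    exact mul_le_mul_of_nonneg_right (Real.exp_le_exp.2 (le_of_abs_le hx)) (hG0 x)

theorem mass_eq (h : Admissible Ω φ β) (f : EuclideanSpace ℝ (Fin N) → ℝ) :
    mass (conformalMetric φ) (fun x => Real.exp (2 * β x)) Ω f =
      ∫ x in Ω, Real.exp (N * φ x + 2 * β x) * f x ^ 2 := by
  rw [mass, h.integral_volumeOn]
  simp only [Real.exp_add, mul_assoc]

theorem energy_eq (h : Admissible Ω φ β) (f : EuclideanSpace ℝ (Fin N) → ℝ) :
    energy (conformalMetric φ) Ω f =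
      ∫ x in Ω, Real.exp ((N - 2) * φ x) * ‖gradVec f x‖ ^ 2 := by
  rw [energy, h.integral_volumeOn]
  refine integral_congr_ae (ae_of_all _ fun x => ?_)
  simp only [coInner_conformalMetric_self]
  rw [← mul_assoc, ← Real.exp_add]
  ring_nf

/-- On test functions, `L²` norms and mass, and gradient norms and energy, are comparable. -/
theorem exists_mass_energy_bound (h : Admissible Ω φ β) :
    ∃ K, 0 ≤ K ∧ ∀ f, IsTestFunction Ω f →
      ∫ x, f x ^ 2 ≤ K * mass (conformalMetric φ) (fun x => Real.exp (2 * β x)) Ω f ∧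
      mass (conformalMetric φ) (fun x => Real.exp (2 * β x)) Ω f ≤ K * ∫ x, f x ^ 2 ∧
      ∫ x, ‖fderiv ℝ f x‖ ^ 2 ≤ K * energy (conformalMetric φ) Ω f := by
  obtain ⟨K₁, hK₁, h₁⟩ := h.exists_integral_exp_mul_comparison
    (γ := fun x => N * φ x + 2 * β x) ((h.metric.const_mul _).add (h.weight.const_mul _))
  obtain ⟨K₂, hK₂, h₂⟩ := h.exists_integral_exp_mul_comparison
    (γ := fun x => (N - 2) * φ x) (h.metric.const_mul _)
  refine ⟨max K₁ K₂, le_max_of_le_left hK₁, fun f hf => ?_⟩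
  have hm := h₁ (fun x => f x ^ 2) (hf.1.continuous.pow 2)
    (hasCompactSupport_sq ⟨f, hf⟩) (tsupport_sq_subset ⟨f, hf⟩)
    (fun x => sq_nonneg _)
  have he := h₂ (fun x => ‖gradVec f x‖ ^ 2) ((continuous_gradVec hf.1).norm.pow 2)
    (hf.2.mono' fun x hx => by by_contra h'; exact hx (by simp [gradVec_eq_zero h']))
    ((tsupport_subset_of_eq_zero fun x hx => by simp [gradVec_eq_zero hx]).trans hf.3)
    (fun x => sq_nonneg _)
  rw [← h.mass_eq] at hm
  rw [← h.energy_eq] at he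
  have hm0 : 0 ≤ mass (conformalMetric φ) (fun x => Real.exp (2 * β x)) Ω f :=
    integral_nonneg fun x => by positivity
  have he0 : 0 ≤ energy (conformalMetric φ) Ω f := by
    rw [h.energy_eq]
    exact integral_nonneg fun x => by positivity
  refine ⟨hm.1.trans (mul_le_mul_of_nonneg_right (le_max_left _ _) hm0),
    hm.2.trans (mul_le_mul_of_nonneg_right (le_max_left _ _)
      (integral_nonneg fun x => sq_nonneg _)), ?_⟩
  refine le_trans ?_ (he.1.trans (mul_le_mul_of_nonneg_right (le_max_right _ _) he0))
  refine integral_mono ?_ ?_ fun x => ?_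
  · exact integrable_norm_sq (hf.1.continuous_fderiv (by simp)) (hf.2.fderiv ℝ)
  · exact integrable_norm_sq (continuous_gradVec hf.1) (hasCompactSupport_gradVec hf.2)
  · exact pow_le_pow_left₀ (norm_nonneg _) (norm_fderiv_le_norm_gradVec f x) 2

/-! ### The form domain -/

theorem memLp_exp_smul (h : Admissible Ω φ β) {E : Type*} [NormedAddCommGroup E]
    [NormedSpace ℝ E] {γ : EuclideanSpace ℝ (Fin N) → ℝ} (hγ : ContinuousOn γ (closure Ω))
    {F : EuclideanSpace ℝ (Fin N) → E} (hF : MemLp F 2 (volumeOn (conformalMetric φ) Ω)) :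
    MemLp (fun x => Real.exp (γ x) • F x) 2 (volumeOn (conformalMetric φ) Ω) := by
  obtain ⟨K, hK⟩ := h.isCompact.exists_bound_of_continuousOn hγ
  refine hF.of_le_mul (c := Real.exp K) ((h.aestronglyMeasurable hγ.rexp).smul hF.1) ?_
  filter_upwards [h.ae_mem] with x hx
  rw [norm_smul, Real.norm_eq_abs, Real.abs_exp]
  exact mul_le_mul_of_nonneg_right
    (Real.exp_le_exp.2 (le_of_abs_le (hK x (subset_closure hx)))) (norm_nonneg _)

theorem memLp_value (h : Admissible Ω φ β) (f : testSpace Ω) :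
    MemLp (fun x => Real.exp (β x) • f.1 x) 2 (volumeOn (conformalMetric φ) Ω) := by
  have := h.isFiniteMeasure
  exact h.memLp_exp_smul h.weight (f.2.1.continuous.memLp_of_hasCompactSupport f.2.2)

theorem memLp_grad (h : Admissible Ω φ β) (f : testSpace Ω) :
    MemLp (fun x => Real.exp (-φ x) • gradVec f.1 x) 2 (volumeOn (conformalMetric φ) Ω) := by
  have := h.isFiniteMeasure
  exact h.memLp_exp_smul h.metric.neg
    ((continuous_gradVec f.2.1).memLp_of_hasCompactSupport (hasCompactSupport_gradVec f.2.2))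

/-- The embedding `f ↦ (e^β f, e^{-φ} ∇f)` of `C_c^∞(Ω)` into `L² × L²`. The weights are chosen so
that the square norms of the two components are the mass and the energy. -/
def embed (h : Admissible Ω φ β) : testSpace Ω →ₗ[ℝ]
    HilbertProd (Lp ℝ 2 (volumeOn (conformalMetric φ) Ω))
      (Lp (EuclideanSpace ℝ (Fin N)) 2 (volumeOn (conformalMetric φ) Ω)) where
  toFun f := HilbertProd.mk ((h.memLp_value f).toLp _, (h.memLp_grad f).toLp _)
  map_add' f g := by
    rw [← map_add, Prod.mk_add_mk, ← MemLp.toLp_add, ← MemLp.toLp_add]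
    congr 2
    · refine MemLp.toLp_congr _ _ (ae_of_all _ fun x => ?_)
      simp [mul_add]
    · refine MemLp.toLp_congr _ _ (ae_of_all _ fun x => ?_)
      simp [gradVec_add]
  map_smul' c f := by
    rw [← map_smul, RingHom.id_apply, Prod.smul_mk, ← MemLp.toLp_const_smul,
      ← MemLp.toLp_const_smul]
    congr 2
    · refine MemLp.toLp_congr _ _ (ae_of_all _ fun x => ?_)
      simp [mul_left_comm]
    · refine MemLp.toLp_congr _ _ (ae_of_all _ fun x => ?_)
      simp [gradVec_smul, smul_comm c]

theorem norm_embed_fst_sq (h : Admissible Ω φ β) (f : testSpace Ω) :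
    ‖HilbertProd.fst (h.embed f)‖ ^ 2 =
      mass (conformalMetric φ) (fun x => Real.exp (2 * β x)) Ω f.1 := by
  refine (norm_toLp_two_sq (h.memLp_value f)).trans (integral_congr_ae (ae_of_all _ fun x => ?_))
  simp only [smul_eq_mul, Real.norm_eq_abs, sq_abs]
  rw [mul_pow, ← Real.exp_nat_mul]
  norm_num

theorem norm_embed_snd_sq (h : Admissible Ω φ β) (f : testSpace Ω) :
    ‖HilbertProd.snd (h.embed f)‖ ^ 2 = energy (conformalMetric φ) Ω f.1 := by
  refine (norm_toLp_two_sq (h.memLp_grad f)).trans (integral_congr_ae (ae_of_all _ fun x => ?_))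
  simp only [coInner_conformalMetric_self, norm_smul, Real.norm_eq_abs, mul_pow, sq_abs]
  rw [← Real.exp_nat_mul]
  norm_num

theorem norm_embed_sq (h : Admissible Ω φ β) (f : testSpace Ω) :
    ‖h.embed f‖ ^ 2 = mass (conformalMetric φ) (fun x => Real.exp (2 * β x)) Ω f.1 +
      energy (conformalMetric φ) Ω f.1 := by
  rw [HilbertProd.norm_sq_eq, norm_embed_fst_sq, norm_embed_snd_sq]

/-- The Sobolev space `H^1_0(Ω)`: the closure of the embedded test functions. -/
def formDomain (h : Admissible Ω φ β) : Submodule ℝ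
    (HilbertProd (Lp ℝ 2 (volumeOn (conformalMetric φ) Ω))
      (Lp (EuclideanSpace ℝ (Fin N)) 2 (volumeOn (conformalMetric φ) Ω))) :=
  h.embed.range.topologicalClosure

instance completeSpace_formDomain (h : Admissible Ω φ β) : CompleteSpace h.formDomain :=
  Submodule.topologicalClosure.completeSpace _

/-- The embedding of `C_c^∞(Ω)` into `H^1_0(Ω)`. -/
def toFormDomain (h : Admissible Ω φ β) : testSpace Ω →ₗ[ℝ] h.formDomain :=
  h.embed.codRestrict h.formDomain fun f => subset_closure ⟨f, rfl⟩

theorem coe_toFormDomain (h : Admissible Ω φ β) (f : testSpace Ω) :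
    (h.toFormDomain f).1 = h.embed f := rfl

theorem denseRange_toFormDomain (h : Admissible Ω φ β) : DenseRange h.toFormDomain := by
  intro x
  rw [closure_subtype]
  refine closure_mono ?_ x.2
  rintro _ ⟨f, rfl⟩
  exact ⟨_, ⟨f, rfl⟩, rfl⟩

/-- The inclusion of `H^1_0(Ω)` into `L²`, up to the weight `e^β`. -/
def inclusion (h : Admissible Ω φ β) :
    h.formDomain →L[ℝ] Lp ℝ 2 (volumeOn (conformalMetric φ) Ω) :=
  HilbertProd.fst.comp h.formDomain.subtypeL

theorem inclusion_apply (h : Admissible Ω φ β) (x : h.formDomain) :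
    h.inclusion x = HilbertProd.fst x.1 := rfl

/-- The unit ball of `H^1_0(Ω)` is approximated by embedded test functions, which lie in a Euclidean
energy ball because the metric and the weight are bounded above and below on `Ω`. Rellich's theorem
applies to that ball. -/
theorem isCompactOperator_inclusion (h : Admissible Ω φ β) : IsCompactOperator h.inclusion := by
  set S := (fun f => HilbertProd.fst (h.embed f)) '' {f : testSpace Ω | ‖h.embed f‖ < 1} with hS
  have hsub : h.inclusion '' Metric.ball 0 1 ⊆ closure S := by
    rintro _ ⟨x, hx, rfl⟩
    have hx1 : ‖x.1‖ < 1 := by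
      simpa using hx
    obtain ⟨y, hy, hyx⟩ := mem_closure_iff_seq_limit.1 x.2
    rw [inclusion_apply]
    refine mem_closure_of_tendsto (HilbertProd.tendsto_fst hyx) ?_
    filter_upwards [hyx.norm.eventually_lt_const hx1] with n hn
    obtain ⟨f, hf⟩ := hy n
    exact ⟨f, by simpa [hf] using hn, by simp [hf]⟩
  have htot : TotallyBounded S := by
    obtain ⟨K, hK0, hK⟩ := h.exists_mass_energy_bound
    have hball : ∀ f : testSpace Ω, ‖h.embed f‖ < 1 → f.1 ∈ energyBall Ω K := by
      intro f hf
      obtain ⟨h1, -, h3⟩ := hK f.1 f.2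
      have h4 := h.norm_embed_sq f
      have h5 : ‖h.embed f‖ ^ 2 ≤ 1 := by nlinarith [norm_nonneg (h.embed f)]
      rw [← h.norm_embed_fst_sq] at h1 h4
      rw [← h.norm_embed_snd_sq] at h3 h4
      refine ⟨f.2.1.of_le (by norm_num), f.2.2, f.2.3, ?_, ?_⟩
      · refine h1.trans (mul_le_of_le_one_right hK0 ?_)
        nlinarith [sq_nonneg ‖HilbertProd.snd (h.embed f)‖]
      · refine h3.trans (mul_le_of_le_one_right hK0 ?_)
        nlinarith [sq_nonneg ‖HilbertProd.fst (h.embed f)‖]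
    refine Metric.totallyBounded_of_finite_discretization fun ε hε => ?_
    obtain ⟨δ, hδ0, hδ⟩ : ∃ δ > 0, K * δ < ε ^ 2 := by
      refine ⟨ε ^ 2 / (K + 1), by positivity, ?_⟩
      rw [← sub_pos]
      have : ε ^ 2 - K * (ε ^ 2 / (K + 1)) = ε ^ 2 / (K + 1) := by field_simp; ring
      rw [this]; positivity
    obtain ⟨ι, hι, F, hF⟩ := exists_finite_discretization_energyBall (Ω := Ω)
      (h.isCompact.isBounded.subset subset_closure) hK0 hδ0
    have hrep : ∀ y : S, ∃ f : testSpace Ω, ‖h.embed f‖ < 1 ∧ HilbertProd.fst (h.embed f) = y :=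
      fun y => y.2
    choose rep hrep1 hrep2 using hrep
    refine ⟨ULift ι, inferInstance, fun y => ⟨F ⟨(rep y).1, hball _ (hrep1 y)⟩⟩, fun y z hyz => ?_⟩
    have h1 := hF _ _ (congrArg ULift.down hyz)
    have h2 : dist (y : Lp ℝ 2 (volumeOn (conformalMetric φ) Ω)) z ^ 2 ≤ K * δ := by
      rw [dist_eq_norm, ← hrep2 y, ← hrep2 z, ← map_sub, ← map_sub, h.norm_embed_fst_sq]
      exact (hK _ (rep y - rep z).2).2.1.trans (mul_le_mul_of_nonneg_left h1 hK0)
    exact lt_of_pow_lt_pow_left₀ 2 hε.le (h2.trans_lt hδ)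
  rw [show (h.inclusion : h.formDomain → _) = (h.inclusion.toLinearMap : h.formDomain → _) from rfl,
    isCompactOperator_iff_isCompact_closure_image_ball _ one_pos]
  exact ((htot.closure.subset hsub).closure).isCompact_of_isClosed isClosed_closure

end Admissible

namespace Admissible

variable {Ω : Set (EuclideanSpace ℝ (Fin N))} {φ β : EuclideanSpace ℝ (Fin N) → ℝ}

open scoped InnerProductSpace

/-! ### Weak eigenfunctions as eigenvectors of a compact operator -/

/-- Multiplication by `e^γ` on `L²`. -/
def mulExp (h : Admissible Ω φ β) {γ : EuclideanSpace ℝ (Fin N) → ℝ}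
    (hγ : ContinuousOn γ (closure Ω)) :
    Lp ℝ 2 (volumeOn (conformalMetric φ) Ω) →ₗ[ℝ] Lp ℝ 2 (volumeOn (conformalMetric φ) Ω) where
  toFun u := (h.memLp_exp_smul hγ (Lp.memLp u)).toLp _
  map_add' u v := by
    rw [← MemLp.toLp_add]
    refine MemLp.toLp_congr _ _ ?_
    filter_upwards [Lp.coeFn_add u v] with x hx
    rw [hx, Pi.add_apply, smul_add]
    rfl
  map_smul' c u := by
    rw [RingHom.id_apply, ← MemLp.toLp_const_smul]
    refine MemLp.toLp_congr _ _ ?_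
    filter_upwards [Lp.coeFn_smul c u] with x hx
    simp [hx, mul_left_comm]

theorem coeFn_mulExp (h : Admissible Ω φ β) {γ : EuclideanSpace ℝ (Fin N) → ℝ}
    (hγ : ContinuousOn γ (closure Ω)) (u : Lp ℝ 2 (volumeOn (conformalMetric φ) Ω)) :
    h.mulExp hγ u =ᵐ[volumeOn (conformalMetric φ) Ω] fun x => Real.exp (γ x) * u x :=
  (h.memLp_exp_smul hγ (Lp.memLp u)).coeFn_toLp

theorem mulExp_neg_mulExp (h : Admissible Ω φ β)
    (u : Lp ℝ 2 (volumeOn (conformalMetric φ) Ω)) :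
    h.mulExp h.weight.neg (h.mulExp h.weight u) = u := by
  refine Lp.ext ?_
  filter_upwards [h.coeFn_mulExp h.weight.neg (h.mulExp h.weight u),
    h.coeFn_mulExp h.weight u] with x h1 h2
  rw [h1, h2, ← mul_assoc, ← Real.exp_add]
  simp

theorem mulExp_mulExp_neg (h : Admissible Ω φ β)
    (u : Lp ℝ 2 (volumeOn (conformalMetric φ) Ω)) :
    h.mulExp h.weight (h.mulExp h.weight.neg u) = u := by
  refine Lp.ext ?_
  filter_upwards [h.coeFn_mulExp h.weight (h.mulExp h.weight.neg u),
    h.coeFn_mulExp h.weight.neg u] with x h1 h2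
  rw [h1, h2, ← mul_assoc, ← Real.exp_add]
  simp

theorem tendsto_eLpNorm_exp_smul (h : Admissible Ω φ β) {E : Type*} [NormedAddCommGroup E]
    [NormedSpace ℝ E] {γ : EuclideanSpace ℝ (Fin N) → ℝ} (hγ : ContinuousOn γ (closure Ω))
    {F : ℕ → EuclideanSpace ℝ (Fin N) → E}
    (hF : Tendsto (fun n => eLpNorm (F n) 2 (volumeOn (conformalMetric φ) Ω)) atTop (𝓝 0)) :
    Tendsto (fun n => eLpNorm (fun x => Real.exp (γ x) • F n x) 2
      (volumeOn (conformalMetric φ) Ω)) atTop (𝓝 0) := by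
  obtain ⟨K, hK⟩ := h.isCompact.exists_bound_of_continuousOn hγ
  have h2 := ENNReal.Tendsto.const_mul hF (Or.inr (ENNReal.ofReal_ne_top (r := Real.exp K)))
  rw [mul_zero] at h2
  refine tendsto_of_tendsto_of_tendsto_of_le_of_le tendsto_const_nhds h2 (fun _ => zero_le)
    fun n => eLpNorm_le_mul_eLpNorm_of_ae_le_mul ?_ _
  filter_upwards [h.ae_mem] with x hx
  rw [norm_smul, Real.norm_eq_abs, Real.abs_exp]
  exact mul_le_mul_of_nonneg_right
    (Real.exp_le_exp.2 (le_of_abs_le (hK x (subset_closure hx)))) (norm_nonneg _)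

theorem coeFn_embed_fst (h : Admissible Ω φ β) (f : testSpace Ω) :
    (HilbertProd.fst (h.embed f) : Lp ℝ 2 (volumeOn (conformalMetric φ) Ω))
      =ᵐ[volumeOn (conformalMetric φ) Ω] fun x => Real.exp (β x) • f.1 x :=
  (h.memLp_value f).coeFn_toLp

theorem coeFn_embed_snd (h : Admissible Ω φ β) (f : testSpace Ω) :
    (HilbertProd.snd (h.embed f) :
        Lp (EuclideanSpace ℝ (Fin N)) 2 (volumeOn (conformalMetric φ) Ω))
      =ᵐ[volumeOn (conformalMetric φ) Ω] fun x => Real.exp (-φ x) • gradVec f.1 x :=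
  (h.memLp_grad f).coeFn_toLp

theorem inner_embed_fst (h : Admissible Ω φ β) (u y : Lp ℝ 2 (volumeOn (conformalMetric φ) Ω))
    (hy : y = h.mulExp h.weight u) (v : testSpace Ω) :
    ⟪y, HilbertProd.fst (h.embed v)⟫_ℝ =
      ∫ x, Real.exp (2 * β x) * u x * v.1 x ∂volumeOn (conformalMetric φ) Ω := by
  rw [L2.inner_def]
  refine integral_congr_ae ?_
  filter_upwards [h.coeFn_embed_fst v, h.coeFn_mulExp h.weight u] with x h1 h2
  rw [hy, h1, h2]
  simp only [smul_eq_mul, RCLike.inner_apply, conj_trivial]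
  rw [two_mul, Real.exp_add]
  ring

theorem inner_embed_snd (h : Admissible Ω φ β)
    (y : Lp (EuclideanSpace ℝ (Fin N)) 2 (volumeOn (conformalMetric φ) Ω))
    (w : EuclideanSpace ℝ (Fin N) → Fin N → ℝ)
    (hw : y =ᵐ[volumeOn (conformalMetric φ) Ω] fun x => Real.exp (-φ x) • WithLp.toLp 2 (w x))
    (v : testSpace Ω) :
    ⟪y, HilbertProd.snd (h.embed v)⟫_ℝ =
      ∫ x, coInner (conformalMetric φ) x (w x) (differential v.1 x)
        ∂volumeOn (conformalMetric φ) Ω := by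
  rw [L2.inner_def]
  refine integral_congr_ae ?_
  filter_upwards [h.coeFn_embed_snd v, hw] with x h1 h2
  rw [h1, h2, coInner_conformalMetric, real_inner_smul_left, real_inner_smul_right, ← mul_assoc,
    ← Real.exp_add, PiLp.inner_apply]
  simp only [gradVec, RCLike.inner_apply, conj_trivial]
  rw [show -φ x + -φ x = -(2 * φ x) by ring]
  congr 1
  exact Finset.sum_congr rfl fun i _ => mul_comm _ _

/-- In `H^1_0(Ω)` the weak equation `-Δu = s ρ u` is an eigenvalue equation for the mass
operator. -/
theorem eq_smul_massOperator_iff_weak (h : Admissible Ω φ β) (x : h.formDomain) (s : ℝ) :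
    x = (s + 1) • massOperator h.inclusion x ↔ ∀ v : testSpace Ω,
      ⟪HilbertProd.snd x.1, HilbertProd.snd (h.embed v)⟫_ℝ =
        s * ⟪HilbertProd.fst x.1, HilbertProd.fst (h.embed v)⟫_ℝ := by
  rw [eq_smul_massOperator_iff h.inclusion h.denseRange_toFormDomain]
  refine forall_congr' fun v => ?_
  have h1 : ⟪x, h.toFormDomain v⟫_ℝ = ⟪HilbertProd.fst x.1, HilbertProd.fst (h.embed v)⟫_ℝ +
      ⟪HilbertProd.snd x.1, HilbertProd.snd (h.embed v)⟫_ℝ := HilbertProd.inner_eq _ _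
  rw [h1, inclusion_apply, inclusion_apply, coe_toFormDomain]
  constructor <;> intro h2 <;> linarith

theorem ofReal_coInner_eq (φ : EuclideanSpace ℝ (Fin N) → ℝ) (x : EuclideanSpace ℝ (Fin N))
    (a b : Fin N → ℝ) :
    ENNReal.ofReal (coInner (conformalMetric φ) x (a - b) (a - b)) = ENNReal.ofReal
      (‖Real.exp (-φ x) • WithLp.toLp 2 a - Real.exp (-φ x) • WithLp.toLp 2 b‖ ^ 2) := by
  congr 1
  rw [← smul_sub, norm_smul, mul_pow, Real.norm_eq_abs, sq_abs, ← Real.exp_nat_mul,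
    ← WithLp.toLp_sub, EuclideanSpace.norm_sq_eq, coInner_conformalMetric]
  congr 1
  · congr 1
    push_cast; ring
  · simp [pow_two]

/-- A weak eigenfunction `u` with weak differential `w` is represented by the pair
`(e^β u, e^{-φ} w)` of the form domain. -/
theorem exists_formDomain_of_solvesDirichlet (h : Admissible Ω φ β) {s : ℝ}
    {u : Lp ℝ 2 (volumeOn (conformalMetric φ) Ω)}
    (hu : SolvesDirichlet (conformalMetric φ) (fun x => Real.exp (2 * β x)) Ω s u) :
    ∃ x : h.formDomain, h.inclusion x = h.mulExp h.weight u ∧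
      x = (s + 1) • massOperator h.inclusion x := by
  obtain ⟨w, ⟨-, hwm, f, hf, hfu, hfw⟩, hweak⟩ := hu
  set F : EuclideanSpace ℝ (Fin N) → EuclideanSpace ℝ (Fin N) :=
    fun x => Real.exp (-φ x) • WithLp.toLp 2 (w x) with hF
  have hFm : AEStronglyMeasurable F (volumeOn (conformalMetric φ) Ω) :=
    (h.aestronglyMeasurable h.metric.neg.rexp).smul
      ((PiLp.continuous_toLp 2 _).comp_aestronglyMeasurable hwm)
  let fn : ℕ → testSpace Ω := fun n => ⟨f n, hf n⟩
  have hgrad : Tendsto (fun n => eLpNorm (fun x => F x - Real.exp (-φ x) • gradVec (f n) x) 2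
      (volumeOn (conformalMetric φ) Ω)) atTop (𝓝 0) := by
    rw [tendsto_eLpNorm_two_iff]
    refine hfw.congr fun n => lintegral_congr fun x => ?_
    exact ofReal_coInner_eq φ x _ _
  have hval : Tendsto (fun n => eLpNorm (fun x => Real.exp (β x) • (u x - f n x)) 2
      (volumeOn (conformalMetric φ) Ω)) atTop (𝓝 0) := by
    refine h.tendsto_eLpNorm_exp_smul h.weight ?_
    rw [tendsto_eLpNorm_two_iff]
    simpa only [Real.norm_eq_abs, sq_abs] using hfu
  have hFL : MemLp F 2 (volumeOn (conformalMetric φ) Ω) := by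
    obtain ⟨n, hn⟩ := (hgrad.eventually_lt_const ENNReal.zero_lt_top).exists
    have h1 : MemLp (fun x => F x - Real.exp (-φ x) • gradVec (f n) x) 2
        (volumeOn (conformalMetric φ) Ω) := ⟨hFm.sub (h.memLp_grad (fn n)).1, hn⟩
    have h2 := h1.add (h.memLp_grad (fn n))
    refine h2.ae_eq (ae_of_all _ fun x => ?_)
    simp [fn]
  have hmem : HilbertProd.mk (h.mulExp h.weight u, hFL.toLp F) ∈ h.formDomain := by
    refine mem_closure_of_tendsto (f := fun n => h.embed (fn n)) (b := atTop) ?_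
      (Eventually.of_forall fun n => ⟨fn n, rfl⟩)
    refine ((HilbertProd.mk (F := Lp ℝ 2 (volumeOn (conformalMetric φ) Ω))
      (G := Lp (EuclideanSpace ℝ (Fin N)) 2 (volumeOn (conformalMetric φ) Ω))).continuous.tendsto
      (h.mulExp h.weight u, hFL.toLp F)).comp (Tendsto.prodMk_nhds ?_ ?_)
    · refine (Lp.tendsto_Lp_iff_tendsto_eLpNorm'' _ (fun n => h.memLp_value (fn n)) _
        (h.memLp_exp_smul h.weight (Lp.memLp u))).2 ?_
      refine hval.congr fun n => ?_
      rw [eLpNorm_sub_comm]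
      congr 1
      funext x
      simp [fn, mul_sub]
    · refine (Lp.tendsto_Lp_iff_tendsto_eLpNorm'' _ (fun n => h.memLp_grad (fn n)) _ _).2 ?_
      refine hgrad.congr fun n => ?_
      rw [eLpNorm_sub_comm]
      rfl
  refine ⟨⟨_, hmem⟩, rfl, (h.eq_smul_massOperator_iff_weak _ s).2 fun v => ?_⟩
  exact (h.inner_embed_snd _ w hFL.coeFn_toLp v).trans ((hweak v.1 v.2).trans
    (congrArg (s * ·) (h.inner_embed_fst u _ rfl v).symm))

/-- An eigenvector of the mass operator gives a weak eigenfunction, whose weak differential is `e^φ`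
times the second component. -/
theorem solvesDirichlet_of_formDomain (h : Admissible Ω φ β) {s : ℝ}
    {u : Lp ℝ 2 (volumeOn (conformalMetric φ) Ω)} {x : h.formDomain}
    (hxu : h.inclusion x = h.mulExp h.weight u) (hx : x = (s + 1) • massOperator h.inclusion x) :
    SolvesDirichlet (conformalMetric φ) (fun x => Real.exp (2 * β x)) Ω s u := by
  set w : EuclideanSpace ℝ (Fin N) → Fin N → ℝ :=
    fun y => WithLp.ofLp (Real.exp (φ y) • HilbertProd.snd x.1 y) with hw
  have hwx : ∀ y, HilbertProd.snd x.1 y = Real.exp (-φ y) • WithLp.toLp 2 (w y) := by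
    intro y
    simp only [hw, WithLp.toLp_ofLp, smul_smul, ← Real.exp_add]
    simp
  have hwm : AEStronglyMeasurable w (volumeOn (conformalMetric φ) Ω) :=
    (PiLp.continuous_ofLp 2 _).comp_aestronglyMeasurable
      ((h.aestronglyMeasurable h.metric.rexp).smul (Lp.aestronglyMeasurable (HilbertProd.snd x.1)))
  obtain ⟨y, hy, hyx⟩ := mem_closure_iff_seq_limit.1 x.2
  choose f hf using hy
  have hyf : y = fun n => h.embed (f n) := funext fun n => (hf n).symm
  subst hyf
  refine ⟨w, ⟨Lp.aestronglyMeasurable u, hwm, fun n => (f n).1, fun n => (f n).2, ?_, ?_⟩, ?_⟩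
  · have h1 := HilbertProd.tendsto_fst hyx
    have h2 := (Lp.tendsto_Lp_iff_tendsto_eLpNorm' _ _).1 h1
    have h3 : Tendsto (fun n => eLpNorm (fun z => Real.exp (β z) • (u z - (f n).1 z)) 2
        (volumeOn (conformalMetric φ) Ω)) atTop (𝓝 0) := by
      refine h2.congr fun n => ?_
      rw [eLpNorm_sub_comm]
      refine eLpNorm_congr_ae ?_
      filter_upwards [h.coeFn_embed_fst (f n), h.coeFn_mulExp h.weight u] with z hz1 hz2
      rw [← hxu, inclusion_apply] at hz2
      simp only [Pi.sub_apply, hz1, hz2, smul_eq_mul, mul_sub]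
    have h4 := h.tendsto_eLpNorm_exp_smul h.weight.neg h3
    rw [tendsto_eLpNorm_two_iff] at h4
    refine h4.congr fun n => lintegral_congr fun z => ?_
    rw [smul_smul, ← Real.exp_add]
    simp
  · have h1 := HilbertProd.tendsto_snd hyx
    have h2 := (Lp.tendsto_Lp_iff_tendsto_eLpNorm' _ _).1 h1
    rw [tendsto_eLpNorm_two_iff] at h2
    refine h2.congr fun n => lintegral_congr_ae ?_
    filter_upwards [h.coeFn_embed_snd (f n)] with z hz
    rw [ofReal_coInner_eq, ← hwx, norm_sub_rev]
    simp only [Pi.sub_apply, hz]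
    rfl
  · intro v hv
    have h1 := (h.eq_smul_massOperator_iff_weak x s).1 hx ⟨v, hv⟩
    rw [h.inner_embed_fst u (HilbertProd.fst x.1) hxu ⟨v, hv⟩,
      h.inner_embed_snd (HilbertProd.snd x.1) w (ae_of_all _ hwx) ⟨v, hv⟩] at h1
    exact h1

end Admissible

/-! ### The variational characterization of the eigenvalues -/

/-- There is a `k`-dimensional space of test functions on which the energy is less than `t` times
the mass. The strict inequality for all nonzero coefficients makes the family independent. -/
def HasTrialSpace (g : EuclideanSpace ℝ (Fin N) → Matrix (Fin N) (Fin N) ℝ)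
    (ρ : EuclideanSpace ℝ (Fin N) → ℝ) (Ω : Set (EuclideanSpace ℝ (Fin N))) (k : ℕ) (t : ℝ) :
    Prop :=
  ∃ f : Fin k → testSpace Ω, ∀ c : Fin k → ℝ, c ≠ 0 →
    energy g Ω (∑ i, c i • f i : testSpace Ω).1 < t * mass g ρ Ω (∑ i, c i • f i : testSpace Ω).1

namespace Admissible

variable {Ω : Set (EuclideanSpace ℝ (Fin N))} {φ β : EuclideanSpace ℝ (Fin N) → ℝ}

theorem energy_nonneg (h : Admissible Ω φ β) (f : EuclideanSpace ℝ (Fin N) → ℝ) :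
    0 ≤ energy (conformalMetric φ) Ω f := by
  rw [h.energy_eq]
  exact integral_nonneg fun x => by positivity

theorem mass_nonneg (φ β f : EuclideanSpace ℝ (Fin N) → ℝ) :
    0 ≤ mass (conformalMetric φ) (fun x => Real.exp (2 * β x)) Ω f :=
  integral_nonneg fun x => by positivity

theorem norm_toFormDomain_sq (h : Admissible Ω φ β) (f : testSpace Ω) :
    ‖h.toFormDomain f‖ ^ 2 = mass (conformalMetric φ) (fun x => Real.exp (2 * β x)) Ω f.1 +
      energy (conformalMetric φ) Ω f.1 :=
  h.norm_embed_sq f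

theorem norm_inclusion_toFormDomain_sq (h : Admissible Ω φ β) (f : testSpace Ω) :
    ‖h.inclusion (h.toFormDomain f)‖ ^ 2 =
      mass (conformalMetric φ) (fun x => Real.exp (2 * β x)) Ω f.1 :=
  h.norm_embed_fst_sq f

theorem pos_of_hasTrialSpace (h : Admissible Ω φ β) {k : ℕ} (hk : 0 < k) {t : ℝ}
    (ht : HasTrialSpace (conformalMetric φ) (fun x => Real.exp (2 * β x)) Ω k t) : 0 < t := by
  obtain ⟨f, hf⟩ := ht
  have hc : (fun _ : Fin k => (1 : ℝ)) ≠ 0 := fun h0 => one_ne_zero (congrFun h0 ⟨0, hk⟩)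
  exact pos_of_mul_pos_left ((h.energy_nonneg _).trans_lt (hf _ hc)) (mass_nonneg _ _ _)

theorem exists_eigenfunctions_of_hasTrialSpace (h : Admissible Ω φ β) {k : ℕ} (hk : 0 < k)
    {t : ℝ} (ht : HasTrialSpace (conformalMetric φ) (fun x => Real.exp (2 * β x)) Ω k t) :
    ∃ u : Fin k → Lp ℝ 2 (volumeOn (conformalMetric φ) Ω), LinearIndependent ℝ u ∧
      ∀ i, ∃ s ≤ t,
        SolvesDirichlet (conformalMetric φ) (fun x => Real.exp (2 * β x)) Ω s (u i) := by
  have ht0 := h.pos_of_hasTrialSpace hk ht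
  obtain ⟨f, hf⟩ := ht
  obtain ⟨x, hli, hx⟩ := exists_eigenvectors_of_trial h.inclusion h.isCompactOperator_inclusion
    (t := t) (by linarith) (fun i => h.toFormDomain (f i)) (by
      intro c hc
      simp only [← map_smul, ← map_sum]
      rw [norm_toFormDomain_sq, norm_inclusion_toFormDomain_sq]
      linarith [hf c hc])
  refine ⟨fun i => h.mulExp h.weight.neg (h.inclusion (x i)), ?_, fun i => ?_⟩
  · refine LinearIndependent.of_comp (h.mulExp h.weight) ?_
    have e : (h.mulExp h.weight ∘ fun i => h.mulExp h.weight.neg (h.inclusion (x i))) =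
        fun i => h.inclusion (x i) := funext fun i => h.mulExp_mulExp_neg _
    rw [e]
    exact hli
  · obtain ⟨s, hst, hs⟩ := hx i
    exact ⟨s, hst, h.solvesDirichlet_of_formDomain (h.mulExp_mulExp_neg _).symm hs⟩

theorem hasTrialSpace_of_eigenfunctions (h : Admissible Ω φ β) {k : ℕ} (hk : 0 < k) {t t' : ℝ}
    (htt' : t < t') {u : Fin k → Lp ℝ 2 (volumeOn (conformalMetric φ) Ω)}
    (hli : LinearIndependent ℝ u)
    (hu : ∀ i, ∃ s ≤ t,
      SolvesDirichlet (conformalMetric φ) (fun x => Real.exp (2 * β x)) Ω s (u i)) :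
    HasTrialSpace (conformalMetric φ) (fun x => Real.exp (2 * β x)) Ω k t' := by
  choose s hst hs using hu
  choose x hxu hx using fun i => h.exists_formDomain_of_solvesDirichlet (hs i)
  have hli' : LinearIndependent ℝ fun i => h.inclusion (x i) := by
    refine LinearIndependent.of_comp (h.mulExp h.weight.neg) ?_
    convert hli using 1
    funext i
    simp only [Function.comp, hxu]
    exact h.mulExp_neg_mulExp _
  obtain ⟨f, hf⟩ := exists_trial_of_eigenvectors h.inclusion h.denseRange_toFormDomain hk htt' x
    hli' fun i => ⟨s i, hst i, hx i⟩
  refine ⟨f, fun c hc => ?_⟩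
  have h1 := hf c hc
  simp only [← map_smul, ← map_sum] at h1
  rw [norm_toFormDomain_sq, norm_inclusion_toFormDomain_sq] at h1
  linarith

theorem mass_pos (h : Admissible Ω φ β) {f : testSpace Ω} {p : EuclideanSpace ℝ (Fin N)}
    (hp : f.1 p ≠ 0) : 0 < mass (conformalMetric φ) (fun x => Real.exp (2 * β x)) Ω f.1 := by
  obtain ⟨K, hK0, hK⟩ := h.exists_mass_energy_bound
  have h1 := (hK f.1 f.2).1
  have h2 : 0 < ∫ x, f.1 x ^ 2 := by
    have hc : Continuous fun x => f.1 x ^ 2 := f.2.1.continuous.pow 2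
    have hi : Integrable fun x => f.1 x ^ 2 := by
      simpa using integrable_norm_sq (μ := volume) f.2.1.continuous f.2.2
    exact hc.integral_pos_of_hasCompactSupport_nonneg_nonzero (hasCompactSupport_sq f)
      (fun x => sq_nonneg _) (x := p) (pow_ne_zero 2 hp)
  by_contra! h3
  nlinarith

/-- Bump functions around distinct points, each vanishing at the other points, are independent, and
on their span the energy is bounded by a multiple of the mass. -/
theorem exists_hasTrialSpace (h : Admissible Ω φ β) (hN : 0 < N) (hne : Ω.Nonempty) (k : ℕ) :
    ∃ t, HasTrialSpace (conformalMetric φ) (fun x => Real.exp (2 * β x)) Ω k t := by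
  have : Nonempty (Fin N) := ⟨⟨0, hN⟩⟩
  obtain ⟨q, hq⟩ := hne
  have hinf : Ω.Infinite := infinite_of_mem_nhds q (h.isOpen.mem_nhds hq)
  obtain ⟨e⟩ : Nonempty (Fin k ↪ Ω) :=
    ⟨(Fin.valEmbedding).trans (hinf.natEmbedding)⟩
  let p : Fin k → EuclideanSpace ℝ (Fin N) := fun i => e i
  have hpinj : Function.Injective p := Subtype.val_injective.comp e.injective
  have hbump : ∀ i, ∃ f : testSpace Ω, f.1 (p i) = 1 ∧ ∀ j, j ≠ i → f.1 (p j) = 0 := by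
    intro i
    have hs : Ω ∩ (p '' {j | j ≠ i})ᶜ ∈ 𝓝 (p i) := by
      refine (h.isOpen.inter (Set.toFinite _).isClosed.isOpen_compl).mem_nhds ⟨(e i).2, ?_⟩
      rintro ⟨j, hj, hji⟩
      exact hj (hpinj hji)
    obtain ⟨f, hf1, hf2, hf3, -, hf5⟩ := exists_contDiff_tsupport_subset (n := ⊤) hs
    refine ⟨⟨f, hf3, hf2, hf1.trans Set.inter_subset_left⟩, hf5, fun j hj => ?_⟩
    exact image_eq_zero_of_notMem_tsupport fun h' => (hf1 h').2 ⟨j, hj, rfl⟩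
  choose f hf1 hf0 using hbump
  have hval : ∀ (c : Fin k → ℝ) i, (∑ j, c j • f j : testSpace Ω).1 (p i) = c i := by
    intro c i
    have : (∑ j, c j • f j : testSpace Ω).1 (p i) = ∑ j, c j * (f j).1 (p i) := by
      simp
    rw [this, Finset.sum_eq_single i (fun j _ hj => by rw [hf0 j i hj.symm, mul_zero]) (by simp),
      hf1, mul_one]
  have hmpos : ∀ c : Fin k → ℝ, c ≠ 0 →
      0 < mass (conformalMetric φ) (fun x => Real.exp (2 * β x)) Ω
        (∑ i, c i • f i : testSpace Ω).1 := by
    intro c hc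
    obtain ⟨i, hi⟩ := Function.ne_iff.1 hc
    exact h.mass_pos (p := p i) (by rw [hval]; exact hi)
  let I : (Fin k → ℝ) → h.formDomain := fun c => ∑ i, c i • h.toFormDomain (f i)
  have hI : ∀ c, I c = h.toFormDomain (∑ i, c i • f i) := fun c => by simp [I]
  have hIc : Continuous I := by fun_prop
  have hm : ∀ c, ‖h.inclusion (I c)‖ ^ 2 = mass (conformalMetric φ)
      (fun x => Real.exp (2 * β x)) Ω (∑ i, c i • f i : testSpace Ω).1 := fun c => by
    rw [hI, norm_inclusion_toFormDomain_sq]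
  -- the ratio of norm and mass is continuous on the unit sphere of coefficients
  have hratio : ContinuousOn (fun c => ‖I c‖ ^ 2 / ‖h.inclusion (I c)‖ ^ 2)
      (Metric.sphere (0 : Fin k → ℝ) 1) := by
    refine ContinuousOn.div (by fun_prop) (by fun_prop) fun c hc => ?_
    rw [hm]
    refine (hmpos c ?_).ne'
    rintro rfl
    simp at hc
  obtain ⟨C, hC⟩ := (isCompact_sphere (0 : Fin k → ℝ) 1).exists_bound_of_continuousOn hratio
  refine ⟨C, f, fun c hc => ?_⟩
  have hcn : 0 < ‖c‖ := norm_pos_iff.2 hc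
  have h1 := (le_abs_self _).trans (hC (‖c‖⁻¹ • c) (by simp [norm_smul, hcn.ne']))
  have hIs : I (‖c‖⁻¹ • c) = ‖c‖⁻¹ • I c := by simp [I, Finset.smul_sum, smul_smul]
  have hs : ‖‖c‖⁻¹‖ ^ 2 ≠ 0 := pow_ne_zero 2 (norm_ne_zero_iff.2 (inv_ne_zero hcn.ne'))
  rw [hIs, map_smul, norm_smul, norm_smul, mul_pow, mul_pow, mul_div_mul_left _ _ hs, hm,
    div_le_iff₀ (hmpos c hc), hI, norm_toFormDomain_sq] at h1
  linarith [hmpos c hc]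

/-- Eigenvalues are compared by transplanting trial spaces. -/
theorem dirichletEigenvalue_le_add (h : Admissible Ω φ β) {Ω' : Set (EuclideanSpace ℝ (Fin N))}
    {φ' β' : EuclideanSpace ℝ (Fin N) → ℝ} (h' : Admissible Ω' φ' β') (hN : 0 < N)
    (hne : Ω.Nonempty) {k : ℕ} (hk : 0 < k) {d : ℝ}
    (htrial : ∀ t, HasTrialSpace (conformalMetric φ) (fun x => Real.exp (2 * β x)) Ω k t →
      HasTrialSpace (conformalMetric φ') (fun x => Real.exp (2 * β' x)) Ω' k (t + d)) :
    dirichletEigenvalue (conformalMetric φ') (fun x => Real.exp (2 * β' x)) Ω' k ≤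
      dirichletEigenvalue (conformalMetric φ) (fun x => Real.exp (2 * β x)) Ω k + d := by
  refine le_of_forall_pos_le_add fun ε hε => ?_
  obtain ⟨t₀, ht₀⟩ := h.exists_hasTrialSpace hN hne k
  obtain ⟨t, ⟨u, hli, hu⟩, ht⟩ := exists_lt_of_csInf_lt
    ⟨t₀, h.exists_eigenfunctions_of_hasTrialSpace hk ht₀⟩ (lt_add_of_pos_right
    (dirichletEigenvalue (conformalMetric φ) (fun x => Real.exp (2 * β x)) Ω k) hε)
  have h1 := htrial _ (h.hasTrialSpace_of_eigenfunctions hk ht hli hu)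
  have h2 : dirichletEigenvalue (conformalMetric φ') (fun x => Real.exp (2 * β' x)) Ω' k ≤
      dirichletEigenvalue (conformalMetric φ) (fun x => Real.exp (2 * β x)) Ω k + ε + d := by
    refine csInf_le ⟨0, ?_⟩ (h'.exists_eigenfunctions_of_hasTrialSpace hk h1)
    rintro s ⟨v, hvli, hv⟩
    exact le_of_forall_gt fun s' hs' =>
      h'.pos_of_hasTrialSpace hk (h'.hasTrialSpace_of_eigenfunctions hk hs' hvli hv)
  linarith

end Admissible

/-! ### Scalar curvature of a conformally flat metric -/

theorem contDiffOn_pderiv {U : Set (EuclideanSpace ℝ (Fin N))} (hU : IsOpen U)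
    {f : EuclideanSpace ℝ (Fin N) → ℝ} (hf : ContDiffOn ℝ ∞ f U) (i : Fin N) :
    ContDiffOn ℝ ∞ (pderiv i f) U :=
  (hf.fderiv_of_isOpen hU (by simp)).clm_apply contDiffOn_const

theorem pderiv_congr {i : Fin N} {f g : EuclideanSpace ℝ (Fin N) → ℝ}
    {x : EuclideanSpace ℝ (Fin N)} (h : f =ᶠ[𝓝 x] g) : pderiv i f x = pderiv i g x := by
  rw [pderiv, pderiv, h.fderiv_eq]

theorem pderiv_eq_of_hasFDerivAt {i : Fin N} {f : EuclideanSpace ℝ (Fin N) → ℝ}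
    {f' : EuclideanSpace ℝ (Fin N) →L[ℝ] ℝ} {x : EuclideanSpace ℝ (Fin N)}
    (h : HasFDerivAt f f' x) : pderiv i f x = f' (EuclideanSpace.single i 1) := by
  rw [pderiv, h.fderiv]

/-- The Christoffel symbols of `e^{2φ} g_E`. -/
theorem christoffel_conformalMetric {φ : EuclideanSpace ℝ (Fin N) → ℝ}
    {x : EuclideanSpace ℝ (Fin N)} (hφ : DifferentiableAt ℝ φ x) (k i j : Fin N) :
    christoffel (conformalMetric φ) k i j x = (if j = k then pderiv i φ x else 0) +
      (if i = k then pderiv j φ x else 0) - (if i = j then pderiv k φ x else 0) := by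
  have hg : ∀ a b c : Fin N, pderiv a (fun y => conformalMetric φ y b c) x =
      Real.exp (2 * φ x) * (2 * if b = c then pderiv a φ x else 0) := by
    intro a b c
    have h1 : HasFDerivAt (fun y => conformalMetric φ y b c)
        ((if b = c then (1 : ℝ) else 0) • (Real.exp (2 * φ x) • ((2 : ℝ) • fderiv ℝ φ x))) x := by
      have h2 := ((hφ.hasFDerivAt.const_mul 2).exp).const_mul (if b = c then (1 : ℝ) else 0)
      refine h2.congr_of_eventuallyEq (Eventually.of_forall fun y => ?_)
      simp [conformalMetric, euclideanMetric, Matrix.one_apply]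
    rw [pderiv_eq_of_hasFDerivAt h1]
    by_cases hbc : b = c <;> simp [hbc, pderiv]
  simp only [christoffel, hg, conformalMetric_inv, Matrix.smul_apply, Matrix.one_apply, smul_eq_mul]
  rw [Finset.sum_eq_single k (fun l _ hl => by simp [hl.symm]) (by simp)]
  have he : Real.exp (-(2 * φ x)) * Real.exp (2 * φ x) = 1 := by
    rw [← Real.exp_add]; simp
  simp only [if_true, mul_one]
  linear_combination ((if j = k then pderiv i φ x else 0) +
      (if i = k then pderiv j φ x else 0) - (if i = j then pderiv k φ x else 0)) * he

theorem pderiv_christoffel_conformalMetric {U : Set (EuclideanSpace ℝ (Fin N))} (hU : IsOpen U)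
    {φ : EuclideanSpace ℝ (Fin N) → ℝ} (hφ : ContDiffOn ℝ ∞ φ U) {x : EuclideanSpace ℝ (Fin N)}
    (hx : x ∈ U) (a k i j : Fin N) :
    pderiv a (christoffel (conformalMetric φ) k i j) x =
      (if j = k then pderiv a (pderiv i φ) x else 0) +
      (if i = k then pderiv a (pderiv j φ) x else 0) -
      (if i = j then pderiv a (pderiv k φ) x else 0) := by
  have hev : christoffel (conformalMetric φ) k i j =ᶠ[𝓝 x] fun y =>
      (if j = k then (1 : ℝ) else 0) * pderiv i φ y + (if i = k then 1 else 0) * pderiv j φ y -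
        (if i = j then 1 else 0) * pderiv k φ y := by
    filter_upwards [hU.mem_nhds hx] with y hy
    rw [christoffel_conformalMetric ((hφ.contDiffAt (hU.mem_nhds hy)).differentiableAt (by simp))]
    simp
  have hd : ∀ b, HasFDerivAt (pderiv b φ) (fderiv ℝ (pderiv b φ) x) x := fun b =>
    (((contDiffOn_pderiv hU hφ b).contDiffAt (hU.mem_nhds hx)).differentiableAt
      (by simp)).hasFDerivAt
  refine (pderiv_congr hev).trans ((pderiv_eq_of_hasFDerivAt
    ((((hd i).const_mul _).add ((hd j).const_mul _)).sub ((hd k).const_mul _))).trans ?_)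
  simp only [pderiv]
  split_ifs <;> simp

/-- The contraction of the curvature tensor for Christoffel symbols of conformal type, as a purely
algebraic identity: `p` stands for the gradient and `H` for the Hessian of the conformal exponent,
`dΓ a k i j` for `∂_a Γ^k_{ij}`. -/
theorem sum_conformal_curvature (p : Fin N → ℝ) (H : Fin N → Fin N → ℝ)
    (Γ : Fin N → Fin N → Fin N → ℝ)
    (hΓ : ∀ k i j, Γ k i j = (if j = k then p i else 0) + (if i = k then p j else 0) -
      (if i = j then p k else 0))
    (dΓ : Fin N → Fin N → Fin N → Fin N → ℝ)
    (hdΓ : ∀ a k i j, dΓ a k i j = (if j = k then H a i else 0) + (if i = k then H a j else 0) -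
      (if i = j then H a k else 0)) :
    ∑ k, ∑ i, (dΓ i i k k - dΓ k i i k + ∑ m, (Γ i i m * Γ m k k - Γ i k m * Γ m i k)) =
      -(2 * ((N : ℝ) - 1) * ∑ i, H i i + ((N : ℝ) - 1) * ((N : ℝ) - 2) * ∑ i, p i ^ 2) := by
  have e1 : ∑ k, ∑ i, dΓ i i k k = (2 - (N : ℝ)) * ∑ i, H i i := by
    have : ∀ k i, dΓ i i k k = 2 * (if k = i then H i i else 0) - H i i := by
      intro k i
      rw [hdΓ]
      by_cases h : k = i
      · subst h; simp; ring
      · simp [h]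
    simp only [this, Finset.sum_sub_distrib, ← Finset.mul_sum]
    simp
    ring
  have e2 : ∑ k, ∑ i, dΓ k i i k = (N : ℝ) * ∑ i, H i i := by
    have : ∀ k i, dΓ k i i k = H k k := by
      intro k i
      rw [hdΓ]
      by_cases h : k = i
      · subst h; simp
      · simp [h, Ne.symm h]
    simp [this, Finset.mul_sum]
  have e3 : ∑ k, ∑ i, ∑ m, Γ i i m * Γ m k k = (N : ℝ) * (2 - N) * ∑ i, p i ^ 2 := by
    have : ∀ k i m, Γ i i m * Γ m k k = 2 * (if m = k then p m ^ 2 else 0) - p m ^ 2 := by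
      intro k i m
      have h1 : Γ i i m = p m := by
        rw [hΓ]
        by_cases h : m = i
        · subst h; simp
        · simp [h, Ne.symm h]
      rw [h1, hΓ]
      by_cases h : m = k
      · subst h; simp; ring
      · simp [Ne.symm h, h]; ring
    simp only [this, Finset.sum_sub_distrib, ← Finset.mul_sum]
    simp [← Finset.mul_sum]
    ring
  have e4 : ∑ k, ∑ i, ∑ m, Γ i k m * Γ m i k = (2 - (N : ℝ)) * ∑ i, p i ^ 2 := by
    have : ∀ k i m, Γ i k m * Γ m i k = (if m = i then p k ^ 2 else 0) -
        (if k = i then p m ^ 2 else 0) - (if k = m then p i ^ 2 else 0) +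
        2 * (if k = i then (if k = m then p k ^ 2 else 0) else 0) := by
      intro k i m
      rw [hΓ, hΓ]
      by_cases h1 : m = i
      · subst h1
        by_cases h2 : k = m
        · subst h2; simp; ring
        · simp [h2, Ne.symm h2, pow_two]
      · by_cases h2 : k = i
        · subst h2; simp [h1, Ne.symm h1]; ring
        · by_cases h3 : k = m
          · subst h3; simp [h2, Ne.symm h2]; ring
          · simp [h1, h2, h3, Ne.symm h1, Ne.symm h2]
    simp only [this, Finset.sum_add_distrib, Finset.sum_sub_distrib, ← Finset.mul_sum]
    simp [Finset.sum_ite_eq, ← Finset.mul_sum]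
    ring
  simp only [Finset.sum_add_distrib, Finset.sum_sub_distrib]
  rw [e1, e2, e3, e4]
  ring

/-- The scalar curvature of `e^{2φ} g_E`. -/
theorem scalarCurvature_conformalMetric {U : Set (EuclideanSpace ℝ (Fin N))} (hU : IsOpen U)
    {φ : EuclideanSpace ℝ (Fin N) → ℝ} (hφ : ContDiffOn ℝ ∞ φ U) {x : EuclideanSpace ℝ (Fin N)}
    (hx : x ∈ U) :
    scalarCurvature (conformalMetric φ) x = -(Real.exp (-(2 * φ x)) *
      (2 * ((N : ℝ) - 1) * ∑ i, pderiv i (pderiv i φ) x +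
        ((N : ℝ) - 1) * ((N : ℝ) - 2) * ∑ i, pderiv i φ x ^ 2)) := by
  have hd : DifferentiableAt ℝ φ x := (hφ.contDiffAt (hU.mem_nhds hx)).differentiableAt (by simp)
  rw [← mul_neg, ← sum_conformal_curvature (fun i => pderiv i φ x)
    (fun a i => pderiv a (pderiv i φ) x) (fun k i j => christoffel (conformalMetric φ) k i j x)
    (christoffel_conformalMetric hd)
    (fun a k i j => pderiv a (christoffel (conformalMetric φ) k i j) x)
    (pderiv_christoffel_conformalMetric hU hφ hx)]
  simp only [scalarCurvature, conformalMetric_inv, Matrix.smul_apply, Matrix.one_apply,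
    smul_eq_mul, Finset.mul_sum]
  refine Finset.sum_congr rfl fun k _ => ?_
  rw [Finset.sum_eq_single k (fun l _ hl => by simp [hl.symm]) (by simp)]
  simp [ricciCurvature, riemannCurvature, Finset.mul_sum]

theorem continuousOn_scalarCurvature_conformalMetric {U : Set (EuclideanSpace ℝ (Fin N))}
    (hU : IsOpen U) {φ : EuclideanSpace ℝ (Fin N) → ℝ} (hφ : ContDiffOn ℝ ∞ φ U) :
    ContinuousOn (scalarCurvature (conformalMetric φ)) U := by
  have h1 : ∀ i, ContinuousOn (pderiv i φ) U := fun i => (contDiffOn_pderiv hU hφ i).continuousOn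
  have h2 : ∀ i, ContinuousOn (pderiv i (pderiv i φ)) U := fun i =>
    (contDiffOn_pderiv hU (contDiffOn_pderiv hU hφ i) i).continuousOn
  have h0 := hφ.continuousOn
  refine ContinuousOn.congr ?_ fun x hx => scalarCurvature_conformalMetric hU hφ hx
  fun_prop

/-! ### The conformal change of unknown -/

section Twist

variable {Ω : Set (EuclideanSpace ℝ (Fin N))}

theorem contDiff_mul_of_tsupport_subset (hΩ : IsOpen Ω) {F g : EuclideanSpace ℝ (Fin N) → ℝ}
    {n : WithTop ℕ∞} (hF : ContDiffOn ℝ n F Ω) (hg : ContDiff ℝ n g) (hgΩ : tsupport g ⊆ Ω) :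
    ContDiff ℝ n fun x => F x * g x := by
  rw [contDiff_iff_contDiffAt]
  intro x
  by_cases hx : x ∈ tsupport g
  · exact (hF.contDiffAt (hΩ.mem_nhds (hgΩ hx))).mul hg.contDiffAt
  · refine (contDiffAt_const (c := (0 : ℝ))).congr_of_eventuallyEq ?_
    filter_upwards [(isClosed_tsupport g).isOpen_compl.mem_nhds hx] with y hy
    rw [image_eq_zero_of_notMem_tsupport hy, mul_zero]

theorem integrableOn_mul_of_tsupport_subset
    {F g : EuclideanSpace ℝ (Fin N) → ℝ} (hF : ContinuousOn F Ω) (hg : Continuous g)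
    (hgs : HasCompactSupport g) (hgΩ : tsupport g ⊆ Ω) :
    IntegrableOn (fun x => F x * g x) Ω := by
  have h1 : IntegrableOn (fun x => F x * g x) (tsupport g) :=
    ((hF.mono hgΩ).mul hg.continuousOn).integrableOn_compact hgs
  refine (integrableOn_iff_integrable_of_support_subset (s := tsupport g) ?_).1 h1 |>.integrableOn
  intro x hx
  refine subset_closure fun h0 => hx ?_
  simp [h0]

theorem integrableOn_mul_sq {F : EuclideanSpace ℝ (Fin N) → ℝ} (hF : ContinuousOn F Ω)
    (f : testSpace Ω) : IntegrableOn (fun x => F x * f.1 x ^ 2) Ω :=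
  integrableOn_mul_of_tsupport_subset hF (f.2.1.continuous.pow 2) (hasCompactSupport_sq f)
    (tsupport_sq_subset f)

theorem integral_pderiv_eq_zero {F : EuclideanSpace ℝ (Fin N) → ℝ} (hF : ContDiff ℝ 1 F)
    (hFs : HasCompactSupport F) (i : Fin N) : ∫ x, pderiv i F x = 0 := by
  have hc : Continuous (pderiv i F) := (hF.continuous_fderiv one_ne_zero).clm_apply continuous_const
  have hcs : HasCompactSupport (pderiv i F) := hFs.fderiv_apply ℝ _
  have hi : Integrable fun x => fderiv ℝ F x (EuclideanSpace.single i 1) :=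
    hc.integrable_of_hasCompactSupport hcs
  have h1 := integral_mul_fderiv_eq_neg_fderiv_mul_of_integrable (μ := volume)
    (f := fun _ : EuclideanSpace ℝ (Fin N) => (1 : ℝ)) (g := F) (v := EuclideanSpace.single i 1)
    (by simp) (by simpa using hi)
    (by simpa using hF.continuous.integrable_of_hasCompactSupport hFs)
    (fun x _ => differentiableAt_const _) (fun x _ => hF.differentiable one_ne_zero x)
  simpa [pderiv] using h1

/-- Multiplication by `e^γ` on `C_c^∞(Ω)`. -/
def twist (hΩ : IsOpen Ω) {γ : EuclideanSpace ℝ (Fin N) → ℝ} (hγ : ContDiffOn ℝ ∞ γ Ω) :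
    testSpace Ω →ₗ[ℝ] testSpace Ω where
  toFun f := ⟨fun x => Real.exp (γ x) * f.1 x,
    contDiff_mul_of_tsupport_subset hΩ hγ.exp f.2.1 f.2.3, f.2.2.mul_left,
    (closure_mono (Function.support_mul_subset_right _ _)).trans f.2.3⟩
  map_add' _ _ := Subtype.ext (funext fun _ => mul_add _ _ _)
  map_smul' _ _ := Subtype.ext (funext fun _ => mul_left_comm _ _ _)

theorem twist_apply (hΩ : IsOpen Ω) {γ : EuclideanSpace ℝ (Fin N) → ℝ} (hγ : ContDiffOn ℝ ∞ γ Ω)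
    (f : testSpace Ω) (x : EuclideanSpace ℝ (Fin N)) :
    (twist hΩ hγ f).1 x = Real.exp (γ x) * f.1 x := rfl

theorem twist_twist_neg (hΩ : IsOpen Ω) {γ : EuclideanSpace ℝ (Fin N) → ℝ}
    (hγ : ContDiffOn ℝ ∞ γ Ω) (f : testSpace Ω) : twist hΩ hγ (twist hΩ hγ.neg f) = f := by
  refine Subtype.ext (funext fun x => ?_)
  rw [twist_apply, twist_apply, ← mul_assoc, ← Real.exp_add]
  simp

theorem norm_gradVec_sq (f : EuclideanSpace ℝ (Fin N) → ℝ) (x : EuclideanSpace ℝ (Fin N)) :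
    ‖gradVec f x‖ ^ 2 = ∑ i, pderiv i f x ^ 2 := by
  rw [EuclideanSpace.norm_sq_eq]
  simp [gradVec, differential]

/-- The pointwise identity behind the ground state transform: `|∇(e^{αφ} f)|²` is
`e^{2αφ} |∇f|²` plus a divergence minus a potential. -/
theorem sum_sq_pderiv_exp_mul (hΩ : IsOpen Ω) {φ : EuclideanSpace ℝ (Fin N) → ℝ}
    (hφ : ContDiffOn ℝ ∞ φ Ω) (α : ℝ) {f : EuclideanSpace ℝ (Fin N) → ℝ} (hf : ContDiff ℝ ∞ f)
    {x : EuclideanSpace ℝ (Fin N)} (hx : x ∈ Ω) :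
    ∑ i, pderiv i (fun y => Real.exp (α * φ y) * f y) x ^ 2 =
      Real.exp (2 * α * φ x) * ∑ i, pderiv i f x ^ 2 +
      ∑ i, pderiv i (fun y => Real.exp (2 * α * φ y) * (α * pderiv i φ y) * f y ^ 2) x -
      (α * ∑ i, pderiv i (pderiv i φ) x + α ^ 2 * ∑ i, pderiv i φ x ^ 2) *
        (Real.exp (α * φ x) * f x) ^ 2 := by
  have hφd : HasFDerivAt φ (fderiv ℝ φ x) x :=
    ((hφ.contDiffAt (hΩ.mem_nhds hx)).differentiableAt (by simp)).hasFDerivAt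
  have hpd : ∀ b, HasFDerivAt (pderiv b φ) (fderiv ℝ (pderiv b φ) x) x := fun b =>
    (((contDiffOn_pderiv hΩ hφ b).contDiffAt (hΩ.mem_nhds hx)).differentiableAt
      (by simp)).hasFDerivAt
  have hfd : HasFDerivAt f (fderiv ℝ f x) x := (hf.differentiable (by simp) x).hasFDerivAt
  have h1 : ∀ i, pderiv i (fun y => Real.exp (α * φ y) * f y) x =
      Real.exp (α * φ x) * (pderiv i f x + α * f x * pderiv i φ x) := by
    intro i
    refine (pderiv_eq_of_hasFDerivAt ((hφd.const_mul α).exp.mul hfd)).trans ?_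
    simp [pderiv]
    ring
  have h2 : ∀ i, pderiv i (fun y => Real.exp (2 * α * φ y) * (α * pderiv i φ y) * f y ^ 2) x =
      Real.exp (2 * α * φ x) * (2 * α ^ 2 * pderiv i φ x ^ 2 * f x ^ 2 +
        α * pderiv i (pderiv i φ) x * f x ^ 2 + 2 * α * pderiv i φ x * f x * pderiv i f x) := by
    intro i
    refine (pderiv_eq_of_hasFDerivAt
      (((hφd.const_mul (2 * α)).exp.mul ((hpd i).const_mul α)).mul (hfd.pow 2))).trans ?_
    simp [pderiv]
    ring
  have he : Real.exp (2 * α * φ x) = Real.exp (α * φ x) ^ 2 := by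
    rw [← Real.exp_nat_mul]; congr 1; push_cast; ring
  simp only [h1, h2, he, Finset.mul_sum, ← Finset.sum_add_distrib, add_mul, Finset.sum_mul,
    ← Finset.sum_sub_distrib]
  refine Finset.sum_congr rfl fun i _ => ?_
  ring

end Twist

section Comparison

variable {Ω : Set (EuclideanSpace ℝ (Fin N))} {φ : EuclideanSpace ℝ (Fin N) → ℝ}

/-- The exponent `(N - 2) / 2` makes the substitution `f ↦ e^{(N-2)φ/2} f` preserve the mass:
`Nφ = 2φ + (N - 2)φ`. -/
theorem mass_twist (hΩ : IsOpen Ω) (hφ : ContDiffOn ℝ ∞ φ Ω)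
    (h : Admissible Ω φ fun _ => 0) (h' : Admissible Ω (fun _ => 0) φ) (f : testSpace Ω) :
    mass (conformalMetric fun _ => 0) (fun x => Real.exp (2 * φ x)) Ω
        (twist hΩ (hφ.const_smul (((N : ℝ) - 2) / 2)) f).1 =
      mass (conformalMetric φ) (fun _ => Real.exp (2 * 0)) Ω f.1 := by
  rw [h'.mass_eq, h.mass_eq]
  refine integral_congr_ae (ae_of_all _ fun x => ?_)
  simp only [twist_apply, mul_pow, smul_eq_mul]
  rw [← Real.exp_nat_mul, ← mul_assoc, ← Real.exp_add]
  congr 2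
  push_cast
  ring

/-- The energy of `e^{(N-2)φ/2} f` is the conformal energy of `f` plus the curvature term of the
conformal Laplacian. -/
theorem energy_twist (hN : 2 ≤ N) (hΩ : IsOpen Ω) (hφ : ContDiffOn ℝ ∞ φ Ω)
    (h : Admissible Ω φ fun _ => 0) (h' : Admissible Ω (fun _ => 0) φ) (f : testSpace Ω) :
    energy (conformalMetric fun _ => 0) Ω (twist hΩ (hφ.const_smul (((N : ℝ) - 2) / 2)) f).1 =
      energy (conformalMetric φ) Ω f.1 + ((N : ℝ) - 2) / (4 * ((N : ℝ) - 1)) *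
        ∫ x in Ω, scalarCurvature (conformalMetric φ) x * Real.exp (2 * φ x) *
          (twist hΩ (hφ.const_smul (((N : ℝ) - 2) / 2)) f).1 x ^ 2 := by
  set α : ℝ := ((N : ℝ) - 2) / 2 with hα
  set F := twist hΩ (hφ.const_smul α) f with hF
  have hN1 : (N : ℝ) - 1 ≠ 0 := by
    have : (2 : ℝ) ≤ N := by exact_mod_cast hN
    linarith
  have hp : ∀ i, ContDiffOn ℝ ∞ (pderiv i φ) Ω := fun i => contDiffOn_pderiv hΩ hφ i
  have hpc : ∀ i, ContinuousOn (pderiv i φ) Ω := fun i => (hp i).continuousOn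
  have hppc : ∀ i, ContinuousOn (pderiv i (pderiv i φ)) Ω := fun i =>
    (contDiffOn_pderiv hΩ (hp i) i).continuousOn
  have hφc := hφ.continuousOn
  have hA : IntegrableOn (fun x => Real.exp (2 * α * φ x) * ‖gradVec f.1 x‖ ^ 2) Ω :=
    integrableOn_mul_of_tsupport_subset (by fun_prop)
      ((continuous_gradVec f.2.1).norm.pow 2)
      (f.2.2.mono' fun x hx => by by_contra h0; exact hx (by simp [gradVec_eq_zero h0]))
      ((tsupport_subset_of_eq_zero fun x hx => by simp [gradVec_eq_zero hx]).trans f.2.3)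
  -- the vector field whose divergence appears, compactly supported in `Ω`
  let X : Fin N → EuclideanSpace ℝ (Fin N) → ℝ := fun i y =>
    Real.exp (2 * α * φ y) * (α * pderiv i φ y) * f.1 y ^ 2
  have hXd : ∀ i, ContDiff ℝ 1 (X i) := fun i =>
    (contDiff_mul_of_tsupport_subset hΩ
      ((contDiffOn_const.mul hφ).exp.mul (contDiffOn_const.mul (hp i)))
      (f.2.1.pow 2) (tsupport_sq_subset f)).of_le (by norm_num)
  have hXs : ∀ i, HasCompactSupport (X i) := fun i => (hasCompactSupport_sq f).mul_left
  have hXΩ : ∀ i x, x ∉ Ω → pderiv i (X i) x = 0 := by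
    intro i x hx
    have h1 : x ∉ tsupport (X i) := fun h1 =>
      hx (tsupport_sq_subset f (closure_mono (Function.support_mul_subset_right _ _) h1))
    rw [pderiv, image_eq_zero_of_notMem_tsupport
      (fun h2 => h1 (tsupport_fderiv_subset ℝ h2) : x ∉ tsupport (fderiv ℝ (X i)))]
    rfl
  have hXi : ∀ i, IntegrableOn (pderiv i (X i)) Ω := fun i => by
    have hc : Continuous (pderiv i (X i)) :=
      ((hXd i).continuous_fderiv one_ne_zero).clm_apply continuous_const
    exact (hc.integrable_of_hasCompactSupport ((hXs i).fderiv_apply ℝ _)).integrableOn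
  have hX0 : ∫ x in Ω, ∑ i, pderiv i (X i) x = 0 := by
    rw [integral_finsetSum _ fun i _ => hXi i]
    refine Finset.sum_eq_zero fun i _ => ?_
    rw [setIntegral_eq_integral_of_forall_compl_eq_zero (hXΩ i),
      integral_pderiv_eq_zero (hXd i) (hXs i)]
  have hC : IntegrableOn (fun x => (α * ∑ i, pderiv i (pderiv i φ) x +
      α ^ 2 * ∑ i, pderiv i φ x ^ 2) * F.1 x ^ 2) Ω :=
    integrableOn_mul_sq (by fun_prop) F
  have hS : IntegrableOn (fun x => ∑ i, pderiv i (X i) x) Ω :=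
    integrable_finsetSum _ fun i _ => hXi i
  calc energy (conformalMetric fun _ => 0) Ω F.1
      = ∫ x in Ω, (Real.exp (2 * α * φ x) * ‖gradVec f.1 x‖ ^ 2 + ∑ i, pderiv i (X i) x -
          (α * ∑ i, pderiv i (pderiv i φ) x + α ^ 2 * ∑ i, pderiv i φ x ^ 2) * F.1 x ^ 2) := by
        rw [h'.energy_eq]
        refine setIntegral_congr_fun hΩ.measurableSet fun x hx => ?_
        simp only [mul_zero, Real.exp_zero, one_mul, norm_gradVec_sq]
        exact sum_sq_pderiv_exp_mul hΩ hφ α f.2.1 hx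
    _ = energy (conformalMetric φ) Ω f.1 - ∫ x in Ω, (α * ∑ i, pderiv i (pderiv i φ) x +
          α ^ 2 * ∑ i, pderiv i φ x ^ 2) * F.1 x ^ 2 := by
        have hAS : IntegrableOn (fun x => Real.exp (2 * α * φ x) * ‖gradVec f.1 x‖ ^ 2 +
          ∑ i, pderiv i (X i) x) Ω := hA.add hS
        rw [integral_sub hAS hC, integral_add hA hS, hX0, add_zero, h.energy_eq]
        have h2α : ∀ x, 2 * α * φ x = ((N : ℝ) - 2) * φ x := fun x => by rw [hα]; ring
        simp only [h2α]
    _ = _ := by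
        rw [sub_eq_add_neg, ← integral_neg, ← integral_const_mul]
        congr 1
        refine setIntegral_congr_fun hΩ.measurableSet fun x hx => ?_
        simp only [scalarCurvature_conformalMetric hΩ hφ hx]
        have he : Real.exp (-(2 * φ x)) * Real.exp (2 * φ x) = 1 := by
          rw [← Real.exp_add]; simp
        have h4 : ((N : ℝ) - 2) / (4 * ((N : ℝ) - 1)) * ((N : ℝ) - 1) = α / 2 := by
          rw [hα]; field_simp; ring
        have h5 : (N : ℝ) - 2 = 2 * α := by rw [hα]; ring
        rw [h5] at h4 ⊢
        linear_combination (-(2 * α / (4 * ((N : ℝ) - 1)) * ((N : ℝ) - 1) *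
          (2 * ∑ i, pderiv i (pderiv i φ) x + 2 * α * ∑ i, pderiv i φ x ^ 2) * F.1 x ^ 2)) * (-he) +
          ((2 * ∑ i, pderiv i (pderiv i φ) x + 2 * α * ∑ i, pderiv i φ x ^ 2) * F.1 x ^ 2) * h4

end Comparison

/-! ### Comparison of eigenvalues and gaps -/

/-- Transport of trial spaces. Injectivity of `T` is not needed: it is forced by the strict
inequality. -/
theorem HasTrialSpace.map {g g' : EuclideanSpace ℝ (Fin N) → Matrix (Fin N) (Fin N) ℝ}
    {ρ ρ' : EuclideanSpace ℝ (Fin N) → ℝ} {Ω Ω' : Set (EuclideanSpace ℝ (Fin N))} {k : ℕ}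
    {t t' : ℝ} (T : testSpace Ω →ₗ[ℝ] testSpace Ω')
    (hT : ∀ f : testSpace Ω, energy g Ω f.1 < t * mass g ρ Ω f.1 →
      energy g' Ω' (T f).1 < t' * mass g' ρ' Ω' (T f).1)
    (h : HasTrialSpace g ρ Ω k t) : HasTrialSpace g' ρ' Ω' k t' := by
  obtain ⟨f, hf⟩ := h
  refine ⟨fun i => T (f i), fun c hc => ?_⟩
  simpa only [map_sum, map_smul] using hT _ (hf c hc)

section Gap

variable {Ω : Set (EuclideanSpace ℝ (Fin N))} {φ : EuclideanSpace ℝ (Fin N) → ℝ}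

theorem integral_scalarCurvature_mul_le (hΩ : IsOpen Ω) (hφ : ContDiffOn ℝ ∞ φ Ω)
    (h' : Admissible Ω (fun _ => 0) φ) {r : ℝ}
    (hr : ∀ x ∈ Ω, scalarCurvature (conformalMetric φ) x ≤ r) (f : testSpace Ω) :
    ∫ x in Ω, scalarCurvature (conformalMetric φ) x * Real.exp (2 * φ x) * f.1 x ^ 2 ≤
      r * mass (conformalMetric fun _ => 0) (fun x => Real.exp (2 * φ x)) Ω f.1 := by
  have hR := continuousOn_scalarCurvature_conformalMetric hΩ hφ
  have hφc := hφ.continuousOn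
  rw [h'.mass_eq, ← integral_const_mul]
  simp only [mul_zero, zero_add, ← mul_assoc]
  refine setIntegral_mono_on (integrableOn_mul_sq (by fun_prop) f)
    (integrableOn_mul_sq (by fun_prop) f) hΩ.measurableSet fun x hx => ?_
  have := hr x hx
  gcongr

theorem le_integral_scalarCurvature_mul (hΩ : IsOpen Ω) (hφ : ContDiffOn ℝ ∞ φ Ω)
    (h' : Admissible Ω (fun _ => 0) φ) {r : ℝ}
    (hr : ∀ x ∈ Ω, r ≤ scalarCurvature (conformalMetric φ) x) (f : testSpace Ω) :
    r * mass (conformalMetric fun _ => 0) (fun x => Real.exp (2 * φ x)) Ω f.1 ≤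
      ∫ x in Ω, scalarCurvature (conformalMetric φ) x * Real.exp (2 * φ x) * f.1 x ^ 2 := by
  have hR := continuousOn_scalarCurvature_conformalMetric hΩ hφ
  have hφc := hφ.continuousOn
  rw [h'.mass_eq, ← integral_const_mul]
  simp only [mul_zero, zero_add, ← mul_assoc]
  refine setIntegral_mono_on (integrableOn_mul_sq (by fun_prop) f)
    (integrableOn_mul_sq (by fun_prop) f) hΩ.measurableSet fun x hx => ?_
  have := hr x hx
  gcongr

theorem curvature_coeff_nonneg (hN : 2 ≤ N) : 0 ≤ ((N : ℝ) - 2) / (4 * ((N : ℝ) - 1)) := by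
  have : (2 : ℝ) ≤ N := by exact_mod_cast hN
  exact div_nonneg (by linarith) (by linarith)

/-- An upper curvature bound controls the Euclidean eigenvalues by the conformal ones. -/
theorem dirichletEigenvalue_euclidean_le (hN : 2 ≤ N) (hφ : ContDiffOn ℝ ∞ φ Ω)
    (h : Admissible Ω φ fun _ => 0) (h' : Admissible Ω (fun _ => 0) φ) (hne : Ω.Nonempty)
    {r : ℝ} (hr : ∀ x ∈ Ω, scalarCurvature (conformalMetric φ) x ≤ r) {k : ℕ} (hk : 0 < k) :
    dirichletEigenvalue (conformalMetric fun _ => 0) (fun x => Real.exp (2 * φ x)) Ω k ≤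
      dirichletEigenvalue (conformalMetric φ) (fun _ => Real.exp (2 * 0)) Ω k +
        ((N : ℝ) - 2) / (4 * ((N : ℝ) - 1)) * r := by
  refine h.dirichletEigenvalue_le_add h' (by omega) hne hk fun t ht =>
    ht.map (twist h.isOpen (hφ.const_smul (((N : ℝ) - 2) / 2))) fun f hf => ?_
  have h1 := mul_le_mul_of_nonneg_left (integral_scalarCurvature_mul_le h.isOpen hφ h' hr
    (twist h.isOpen (hφ.const_smul (((N : ℝ) - 2) / 2)) f)) (curvature_coeff_nonneg hN)
  rw [energy_twist hN h.isOpen hφ h h']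
  rw [← mass_twist h.isOpen hφ h h'] at hf
  linarith

/-- A lower curvature bound controls the conformal eigenvalues by the Euclidean ones. -/
theorem dirichletEigenvalue_conformal_le (hN : 2 ≤ N) (hφ : ContDiffOn ℝ ∞ φ Ω)
    (h : Admissible Ω φ fun _ => 0) (h' : Admissible Ω (fun _ => 0) φ) (hne : Ω.Nonempty)
    {r : ℝ} (hr : ∀ x ∈ Ω, r ≤ scalarCurvature (conformalMetric φ) x) {k : ℕ} (hk : 0 < k) :
    dirichletEigenvalue (conformalMetric φ) (fun _ => Real.exp (2 * 0)) Ω k ≤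
      dirichletEigenvalue (conformalMetric fun _ => 0) (fun x => Real.exp (2 * φ x)) Ω k +
        -(((N : ℝ) - 2) / (4 * ((N : ℝ) - 1)) * r) := by
  refine h'.dirichletEigenvalue_le_add h (by omega) hne hk fun t ht =>
    ht.map (twist h.isOpen (hφ.const_smul (((N : ℝ) - 2) / 2)).neg) fun f hf => ?_
  have h1 := mul_le_mul_of_nonneg_left (le_integral_scalarCurvature_mul h.isOpen hφ h' hr f)
    (curvature_coeff_nonneg hN)
  set f' := twist h.isOpen (hφ.const_smul (((N : ℝ) - 2) / 2)).neg f
  have hf' : twist h.isOpen (hφ.const_smul (((N : ℝ) - 2) / 2)) f' = f := twist_twist_neg _ _ f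
  have h2 := energy_twist hN h.isOpen hφ h h' f'
  have h3 := mass_twist h.isOpen hφ h h' f'
  rw [hf'] at h2 h3
  rw [← h3]
  linarith

end Gap

end DirichletGap

end

theorem mainTheorem8 (N : ℕ) (hN : 2 ≤ N)
    (M : Set (EuclideanSpace ℝ (Fin N))) (hM : IsOpen M)
    (φ : EuclideanSpace ℝ (Fin N) → ℝ) (hφ : ContDiffOn ℝ ∞ φ M)
    (Ω : Set (EuclideanSpace ℝ (Fin N))) (hΩ : IsOpen Ω) (hne : Ω.Nonempty)
    (hcpt : IsCompact (closure Ω)) (hΩM : closure Ω ⊆ M) :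
    DirichletGap.fundamentalGap (DirichletGap.conformalMetric φ) (fun _ => 1) Ω ≥
        DirichletGap.fundamentalGap (DirichletGap.euclideanMetric N)
            (fun x => Real.exp (2 * φ x)) Ω
          - ((N : ℝ) - 2) / (4 * ((N : ℝ) - 1)) *
            DirichletGap.osc Ω (DirichletGap.scalarCurvature (DirichletGap.conformalMetric φ)) ∧
      ((∃ c : ℝ, ∀ x ∈ Ω,
          DirichletGap.scalarCurvature (DirichletGap.conformalMetric φ) x = c) →
        DirichletGap.fundamentalGap (DirichletGap.conformalMetric φ) (fun _ => 1) Ω =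
          DirichletGap.fundamentalGap (DirichletGap.euclideanMetric N)
            (fun x => Real.exp (2 * φ x)) Ω) := by
  have hφΩ : ContDiffOn ℝ ∞ φ Ω := hφ.mono (subset_closure.trans hΩM)
  have hφc : ContinuousOn φ (closure Ω) := hφ.continuousOn.mono hΩM
  have h : DirichletGap.Admissible Ω φ fun _ => 0 := ⟨hΩ, hcpt, hφc, continuousOn_const⟩
  have h' : DirichletGap.Admissible Ω (fun _ => 0) φ := ⟨hΩ, hcpt, continuousOn_const, hφc⟩
  have hone : (fun _ : EuclideanSpace ℝ (Fin N) => (1 : ℝ)) = fun _ => Real.exp (2 * 0) := by simp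
  rw [hone, DirichletGap.euclideanMetric_eq_conformalMetric]
  constructor
  · -- the curvature is continuous on the compact set `closure Ω`, so that its supremum and infimum
    -- in `osc` are not junk values
    have hR : ContinuousOn (DirichletGap.scalarCurvature (DirichletGap.conformalMetric φ))
        (closure Ω) :=
      (DirichletGap.continuousOn_scalarCurvature_conformalMetric hM hφ).mono hΩM
    have hsub := Set.image_mono (f := DirichletGap.scalarCurvature (DirichletGap.conformalMetric φ))
      (subset_closure (s := Ω))
    have hmax : ∀ x ∈ Ω, DirichletGap.scalarCurvature (DirichletGap.conformalMetric φ) x ≤ _ :=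
      fun x hx => le_csSup ((hcpt.bddAbove_image hR).mono hsub) (Set.mem_image_of_mem _ hx)
    have hmin : ∀ x ∈ Ω, _ ≤ DirichletGap.scalarCurvature (DirichletGap.conformalMetric φ) x :=
      fun x hx => csInf_le ((hcpt.bddBelow_image hR).mono hsub) (Set.mem_image_of_mem _ hx)
    have h2 := DirichletGap.dirichletEigenvalue_euclidean_le hN hφΩ h h' hne hmax two_pos
    have h1 := DirichletGap.dirichletEigenvalue_conformal_le hN hφΩ h h' hne hmin one_pos
    rw [DirichletGap.fundamentalGap, DirichletGap.fundamentalGap, DirichletGap.osc,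
      mul_sub (_ / _)]
    linarith
  · -- a constant curvature shifts all eigenvalues by the same amount
    rintro ⟨c, hc⟩
    have hle := fun k (hk : 0 < k) =>
      DirichletGap.dirichletEigenvalue_euclidean_le hN hφΩ h h' hne (fun x hx => (hc x hx).le) hk
    have hge := fun k (hk : 0 < k) =>
      DirichletGap.dirichletEigenvalue_conformal_le hN hφΩ h h' hne (fun x hx => (hc x hx).ge) hk
    rw [DirichletGap.fundamentalGap, DirichletGap.fundamentalGap]
    have h1 := hle 1 one_pos
    have h2 := hle 2 two_pos
    have h3 := hge 1 one_pos
    have h4 := hge 2 two_pos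
    generalize ((N : ℝ) - 2) / (4 * ((N : ℝ) - 1)) * c = d at h1 h2 h3 h4
    linarith
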